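/- Let $\mathcal D$ be the algebra of ordinary differential operators $\sum_{j=0}^{n} a_j(x)\partial_x^j$ with coefficients $a_j\in\mathbb C[[x]]$. It is an Ore domain; the elements of its skew field of fractions are called fractional differential operators. For $R,S\in\mathcal D\setminus\{0\}$ the fractional differential operator $S^{-1}R$ has order $\operatorname{ord}R-\operatorname{ord}S\in\mathbb Z$ and leading coefficient equal to the quotient in $\mathbb C((x))$ of the leading coefficients of $R$ and $S$; it is monic if its leading coefficient is $1$. Let $P$ and $Q$ be commuting fractional differential operators, where $P$ is monic of nonzero order and $Q$ is not a constant, i.e. $Q\notin\mathbb C$. Then $P$ and $Q$ are algebraically dependent: there is a nonzero polynomial $F(z,w)\in\mathbb C[z,w]$ with $F(P,Q)=0$. -/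

import Mathlib

noncomputable section

namespace FracDiff

open scoped Polynomial PowerSeries nonZeroDivisors

/-- The derivation `d/dx` of `ℂ[[x]]`, as a `ℂ`-linear endomorphism. -/
def dX : Module.End ℂ ℂ⟦X⟧ := (PowerSeries.derivative ℂ).toLinearMap

/-- The operator `∑ⱼ aⱼ(x) ∂ʲ` on `ℂ[[x]]` with full symbol `∑ⱼ aⱼ Xʲ`. (The scalar multiplication
by `a ∈ ℂ[[x]]` on endomorphisms is composition with multiplication by `a` on the left.) -/
def toEnd : (ℂ⟦X⟧)[X] →ₗ[ℂ⟦X⟧] Module.End ℂ ℂ⟦X⟧ :=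
  Polynomial.lsum fun j => LinearMap.toSpanSingleton ℂ⟦X⟧ (Module.End ℂ ℂ⟦X⟧) (dX ^ j)

theorem toEnd_monomial (j : ℕ) (a : ℂ⟦X⟧) : toEnd (Polynomial.monomial j a) = a • dX ^ j := by
  simp [toEnd, Polynomial.lsum_apply]

theorem toEnd_eq_sum (p : (ℂ⟦X⟧)[X]) : toEnd p = p.sum fun j a => a • dX ^ j := by
  simp [toEnd, Polynomial.lsum_apply]

theorem dX_mul (a f : ℂ⟦X⟧) : dX (a * f) = a * dX f + dX a * f := by
  have h := (PowerSeries.derivative ℂ).leibniz a f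
  rw [smul_eq_mul, smul_eq_mul, mul_comm f] at h
  exact h

theorem dX_pow_X_pow_of_lt {i j : ℕ} (h : j < i) :
    (dX ^ i) ((PowerSeries.X : ℂ⟦X⟧) ^ j) = 0 := by
  have e : (dX ^ i) ((PowerSeries.X : ℂ⟦X⟧) ^ j) =
      (PowerSeries.derivative ℂ)^[i] (PowerSeries.X ^ j) := by
    rw [Module.End.pow_apply]; rfl
  rw [e]
  ext k
  rw [PowerSeries.coeff_iterate_derivative, PowerSeries.coeff_X_pow, if_neg (by omega)]
  simp

theorem dX_pow_X_pow_self (j : ℕ) :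
    (dX ^ j) ((PowerSeries.X : ℂ⟦X⟧) ^ j) = PowerSeries.C (j.factorial : ℂ) := by
  have e : (dX ^ j) ((PowerSeries.X : ℂ⟦X⟧) ^ j) =
      (PowerSeries.derivative ℂ)^[j] (PowerSeries.X ^ j) := by
    rw [Module.End.pow_apply]; rfl
  rw [e]
  ext k
  rw [PowerSeries.coeff_iterate_derivative, PowerSeries.coeff_X_pow, PowerSeries.coeff_C]
  by_cases hk : k = 0
  · subst hk; simp
  · rw [if_neg (by omega), if_neg hk]; simp

/-- A differential operator determines its coefficients. -/
theorem toEnd_injective : Function.Injective toEnd := by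
  rw [injective_iff_map_eq_zero]
  intro p hp
  ext1 j
  rw [Polynomial.coeff_zero]
  induction j using Nat.strong_induction_on with
  | _ j ih =>
    have h1 : toEnd p (PowerSeries.X ^ j) = 0 := by rw [hp]; rfl
    rw [toEnd_eq_sum, Polynomial.sum_def, LinearMap.sum_apply, Finset.sum_eq_single j] at h1
    · rw [LinearMap.smul_apply, dX_pow_X_pow_self, smul_eq_mul, mul_eq_zero] at h1
      rcases h1 with h1 | h1
      · exact h1
      · rw [map_eq_zero_iff _ PowerSeries.C_injective] at h1
        exact absurd h1 (by exact_mod_cast Nat.factorial_ne_zero j)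
    · intro i _ hij
      rcases lt_or_gt_of_ne hij with h | h
      · rw [ih i h]; simp
      · rw [LinearMap.smul_apply, dX_pow_X_pow_of_lt h, smul_zero]
    · intro h
      rw [Polynomial.notMem_support_iff.mp h]; simp

/-- Left composition with `∂`, on full symbols. -/
def dSymb : (ℂ⟦X⟧)[X] →ₗ[ℂ] (ℂ⟦X⟧)[X] where
  toFun q := Polynomial.X * q + q.sum fun j a => Polynomial.monomial j (dX a)
  map_add' p q := by
    rw [Polynomial.sum_add_index p q _ (by simp) (by simp)]; ring
  map_smul' c p := by
    rw [Polynomial.sum_smul_index' _ _ _ (by simp), RingHom.id_apply, smul_add,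
      Polynomial.sum_def, Polynomial.sum_def, Finset.smul_sum, mul_smul_comm]
    refine congrArg _ (Finset.sum_congr rfl fun j _ => ?_)
    rw [Polynomial.smul_monomial, map_smul]

theorem coeff_dSymb (q : (ℂ⟦X⟧)[X]) (n : ℕ) :
    (dSymb q).coeff n = (Polynomial.X * q).coeff n + dX (q.coeff n) := by
  change (Polynomial.X * q + q.sum fun j a => Polynomial.monomial j (dX a)).coeff n = _
  rw [Polynomial.coeff_add, Polynomial.sum_def, Polynomial.finsetSum_coeff]
  congr 1
  simp only [Polynomial.coeff_monomial]
  rw [Finset.sum_ite_eq' q.support n]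
  split_ifs with h
  · rfl
  · rw [Polynomial.notMem_support_iff.mp h, map_zero]

theorem toEnd_dSymb (q : (ℂ⟦X⟧)[X]) : toEnd (dSymb q) = dX * toEnd q := by
  induction q using Polynomial.induction_on' with
  | add p q hp hq => rw [map_add, map_add, map_add, mul_add, hp, hq]
  | monomial n a =>
    have : dSymb (Polynomial.monomial n a) =
        Polynomial.monomial (n + 1) a + Polynomial.monomial n (dX a) := by
      change Polynomial.X * Polynomial.monomial n a + (Polynomial.monomial n a).sum
        (fun j a => Polynomial.monomial j (dX a)) = _
      rw [Polynomial.sum_monomial_index _ _ (by simp), Polynomial.X_mul_monomial]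
    rw [this, map_add, toEnd_monomial, toEnd_monomial, toEnd_monomial]
    ext1 f
    simp only [LinearMap.add_apply, LinearMap.smul_apply, Module.End.mul_apply, smul_eq_mul,
      pow_succ', dX_mul]

theorem toEnd_dSymb_pow (i : ℕ) (q : (ℂ⟦X⟧)[X]) :
    toEnd ((dSymb ^ i) q) = dX ^ i * toEnd q := by
  induction i with
  | zero => simp
  | succ i ih => rw [pow_succ', Module.End.mul_apply, toEnd_dSymb, ih, pow_succ', mul_assoc]

theorem coeff_dSymb_pow_of_lt (i : ℕ) (q : (ℂ⟦X⟧)[X]) (n m : ℕ) (hq : q.natDegree ≤ n)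
    (hm : i + n < m) : ((dSymb ^ i) q).coeff m = 0 := by
  induction i generalizing m with
  | zero => simpa using Polynomial.coeff_eq_zero_of_natDegree_lt (by omega)
  | succ i ih =>
    rw [pow_succ', Module.End.mul_apply, coeff_dSymb, ih m (by omega)]
    obtain ⟨k, rfl⟩ : ∃ k, m = k + 1 := ⟨m - 1, by omega⟩
    rw [Polynomial.coeff_X_mul, ih k (by omega), map_zero, add_zero]

theorem coeff_dSymb_pow_top (i : ℕ) (q : (ℂ⟦X⟧)[X]) (n : ℕ) (hq : q.natDegree ≤ n) :
    ((dSymb ^ i) q).coeff (i + n) = q.coeff n := by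
  induction i with
  | zero => simp
  | succ i ih =>
    rw [pow_succ', Module.End.mul_apply, coeff_dSymb, show i + 1 + n = (i + n) + 1 by ring,
      Polynomial.coeff_X_mul, ih, coeff_dSymb_pow_of_lt i q n _ hq (by omega), map_zero, add_zero]

/-- Composition of differential operators, on full symbols. -/
def star (p q : (ℂ⟦X⟧)[X]) : (ℂ⟦X⟧)[X] := p.sum fun i a => a • (dSymb ^ i) q

theorem toEnd_star (p q : (ℂ⟦X⟧)[X]) : toEnd (star p q) = toEnd p * toEnd q := by
  rw [star, toEnd_eq_sum p, Polynomial.sum_def, Polynomial.sum_def, map_sum, Finset.sum_mul]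
  refine Finset.sum_congr rfl fun i _ => ?_
  rw [map_smul, toEnd_dSymb_pow]
  rfl

theorem coeff_star_of_lt (p q : (ℂ⟦X⟧)[X]) (k n m : ℕ) (hp : p.natDegree ≤ k)
    (hq : q.natDegree ≤ n) (hm : k + n < m) : (star p q).coeff m = 0 := by
  rw [star, Polynomial.sum_def, Polynomial.finsetSum_coeff]
  refine Finset.sum_eq_zero fun i hi => ?_
  have := Polynomial.le_natDegree_of_mem_supp i hi
  rw [Polynomial.coeff_smul, coeff_dSymb_pow_of_lt i q n m hq (by omega), smul_zero]

theorem coeff_star_top (p q : (ℂ⟦X⟧)[X]) :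
    (star p q).coeff (p.natDegree + q.natDegree) = p.leadingCoeff * q.leadingCoeff := by
  rw [star, Polynomial.sum_def, Polynomial.finsetSum_coeff, Finset.sum_eq_single p.natDegree]
  · rw [Polynomial.coeff_smul, coeff_dSymb_pow_top _ _ _ le_rfl]; rfl
  · intro i hi hne
    have := Polynomial.le_natDegree_of_mem_supp i hi
    rw [Polynomial.coeff_smul, coeff_dSymb_pow_of_lt i q _ _ le_rfl (by omega), smul_zero]
  · intro h
    rw [Polynomial.notMem_support_iff.mp h, zero_smul, Polynomial.coeff_zero]

theorem natDegree_star {p q : (ℂ⟦X⟧)[X]} (hp : p ≠ 0) (hq : q ≠ 0) :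
    (star p q).natDegree = p.natDegree + q.natDegree := by
  refine le_antisymm ?_ (Polynomial.le_natDegree_of_ne_zero ?_)
  · rw [Polynomial.natDegree_le_iff_coeff_eq_zero]
    exact fun m hm => coeff_star_of_lt p q _ _ m le_rfl le_rfl hm
  · rw [coeff_star_top]
    exact mul_ne_zero (Polynomial.leadingCoeff_ne_zero.mpr hp)
      (Polynomial.leadingCoeff_ne_zero.mpr hq)

theorem leadingCoeff_star {p q : (ℂ⟦X⟧)[X]} (hp : p ≠ 0) (hq : q ≠ 0) :
    (star p q).leadingCoeff = p.leadingCoeff * q.leadingCoeff := by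
  rw [Polynomial.leadingCoeff, natDegree_star hp hq, coeff_star_top]

/-- The algebra of ordinary differential operators `∑ⱼ aⱼ(x) ∂ʲ` (finite sums) with coefficients
in `ℂ[[x]]`; the product is composition. -/
def diffOpAlgebra : Subalgebra ℂ (Module.End ℂ ℂ⟦X⟧) where
  carrier := Set.range toEnd
  add_mem' := by
    rintro _ _ ⟨p, rfl⟩ ⟨q, rfl⟩
    exact ⟨p + q, map_add _ _ _⟩
  mul_mem' := by
    rintro _ _ ⟨p, rfl⟩ ⟨q, rfl⟩
    exact ⟨star p q, toEnd_star p q⟩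
  algebraMap_mem' c := by
    refine ⟨Polynomial.monomial 0 (PowerSeries.C c), ?_⟩
    rw [toEnd_monomial, pow_zero]
    ext1 f
    simp [Module.algebraMap_end_apply, PowerSeries.smul_eq_C_mul]

/-- The type of ordinary differential operators with coefficients in `ℂ[[x]]`. -/
def DiffOp : Type := diffOpAlgebra

namespace DiffOp

instance instRing : Ring DiffOp := inferInstanceAs (Ring diffOpAlgebra)

instance instAlgebra : Algebra ℂ DiffOp := inferInstanceAs (Algebra ℂ diffOpAlgebra)

instance instNontrivial : Nontrivial DiffOp := inferInstanceAs (Nontrivial diffOpAlgebra)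

/-- The differential operator `∑ⱼ aⱼ(x) ∂ʲ` with full symbol `∑ⱼ aⱼ Xʲ`. -/
def ofSymbol (p : (ℂ⟦X⟧)[X]) : DiffOp := ⟨toEnd p, p, rfl⟩

/-- The full symbol `∑ⱼ aⱼ Xʲ` of the differential operator `∑ⱼ aⱼ(x) ∂ʲ`. -/
def symbol (L : DiffOp) : (ℂ⟦X⟧)[X] := Classical.choose L.2

theorem toEnd_symbol (L : DiffOp) : toEnd (symbol L) = L.1 := Classical.choose_spec L.2

@[simp] theorem ofSymbol_symbol (L : DiffOp) : ofSymbol (symbol L) = L :=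
  Subtype.ext (toEnd_symbol L)

@[simp] theorem symbol_ofSymbol (p : (ℂ⟦X⟧)[X]) : symbol (ofSymbol p) = p :=
  toEnd_injective (toEnd_symbol (ofSymbol p))

theorem symbol_mul (L M : DiffOp) : symbol (L * M) = star (symbol L) (symbol M) := by
  apply toEnd_injective
  rw [toEnd_symbol, toEnd_star, toEnd_symbol, toEnd_symbol]; rfl

theorem symbol_eq_zero {L : DiffOp} : symbol L = 0 ↔ L = 0 := by
  constructor
  · intro h
    apply Subtype.ext
    rw [← toEnd_symbol, h, map_zero]; rfl
  · rintro rfl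
    apply toEnd_injective
    rw [toEnd_symbol, map_zero]; rfl

/-- The order of a differential operator (with value `0` at the zero operator). -/
def order (L : DiffOp) : ℕ := (symbol L).natDegree

/-- The leading coefficient of a differential operator, an element of `ℂ[[x]]`. -/
def leadingCoeff (L : DiffOp) : ℂ⟦X⟧ := (symbol L).leadingCoeff

theorem leadingCoeff_eq_zero {L : DiffOp} : leadingCoeff L = 0 ↔ L = 0 := by
  rw [leadingCoeff, Polynomial.leadingCoeff_eq_zero, symbol_eq_zero]

theorem order_mul {L M : DiffOp} (hL : L ≠ 0) (hM : M ≠ 0) :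
    order (L * M) = order L + order M := by
  rw [order, symbol_mul, natDegree_star (symbol_eq_zero.not.mpr hL) (symbol_eq_zero.not.mpr hM)]
  rfl

theorem leadingCoeff_mul (L M : DiffOp) :
    leadingCoeff (L * M) = leadingCoeff L * leadingCoeff M := by
  by_cases hL : L = 0
  · rw [hL, zero_mul, leadingCoeff_eq_zero.mpr rfl, zero_mul]
  by_cases hM : M = 0
  · rw [hM, mul_zero, leadingCoeff_eq_zero.mpr rfl, mul_zero]
  rw [leadingCoeff, symbol_mul,
    leadingCoeff_star (symbol_eq_zero.not.mpr hL) (symbol_eq_zero.not.mpr hM)]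
  rfl

instance instNoZeroDivisors : NoZeroDivisors DiffOp where
  eq_zero_or_eq_zero_of_mul_eq_zero := by
    intro L M h
    rw [← leadingCoeff_eq_zero, leadingCoeff_mul, mul_eq_zero, leadingCoeff_eq_zero,
      leadingCoeff_eq_zero] at h
    exact h

/-- Right composition with a fixed operator, on full symbols. -/
def starRight (q : (ℂ⟦X⟧)[X]) : (ℂ⟦X⟧)[X] →ₗ[ℂ⟦X⟧] (ℂ⟦X⟧)[X] where
  toFun p := star p q
  map_add' p p' := by
    apply toEnd_injective
    rw [toEnd_star, map_add, map_add, toEnd_star, toEnd_star, add_mul]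
  map_smul' a p := by
    apply toEnd_injective
    rw [toEnd_star, map_smul, RingHom.id_apply, map_smul, toEnd_star]
    rfl

theorem exists_star_eq (a b : (ℂ⟦X⟧)[X]) (hb : b ≠ 0) :
    ∃ u v : (ℂ⟦X⟧)[X], u ≠ 0 ∧ star u a = star v b := by
  set n := a.natDegree with hn
  set m := b.natDegree with hm
  let f : (Polynomial.degreeLT ℂ⟦X⟧ (m + 1) × Polynomial.degreeLT ℂ⟦X⟧ (n + 1)) →ₗ[ℂ⟦X⟧] (Fin (m + n + 1) → ℂ⟦X⟧) :=
    { toFun := fun w i => (starRight a w.1 - starRight b w.2).coeff i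
      map_add' := fun w w' => by
        ext1 i
        simp only [Prod.fst_add, Prod.snd_add, Submodule.coe_add, map_add, Polynomial.coeff_sub,
          Polynomial.coeff_add, Pi.add_apply]
        ring
      map_smul' := fun c w => by
        ext1 i
        simp only [Prod.smul_fst, Prod.smul_snd, Submodule.coe_smul, map_smul,
          Polynomial.coeff_sub, Polynomial.coeff_smul, Pi.smul_apply, smul_eq_mul,
          RingHom.id_apply]
        ring }
  have hf : ¬ Function.Injective f := by
    intro h
    let e := (Polynomial.degreeLTEquiv ℂ⟦X⟧ (m + 1)).symm.prodCongr (Polynomial.degreeLTEquiv ℂ⟦X⟧ (n + 1)).symm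
    have h2 := LinearMap.finrank_le_finrank_of_injective
      (f := f.comp e.toLinearMap) (h.comp e.injective)
    rw [Module.finrank_prod, Module.finrank_fin_fun, Module.finrank_fin_fun,
      Module.finrank_fin_fun] at h2
    omega
  rw [injective_iff_map_eq_zero] at hf
  push Not at hf
  obtain ⟨⟨⟨u, hu⟩, ⟨v, hv⟩⟩, hw, hne⟩ := hf
  have hud : u.natDegree ≤ m := by
    rw [Polynomial.degreeLT_succ_eq_degreeLE, Polynomial.mem_degreeLE] at hu
    exact Polynomial.natDegree_le_of_degree_le hu
  have hvd : v.natDegree ≤ n := by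
    rw [Polynomial.degreeLT_succ_eq_degreeLE, Polynomial.mem_degreeLE] at hv
    exact Polynomial.natDegree_le_of_degree_le hv
  have heq : star u a = star v b := by
    ext1 k
    by_cases hk : k < m + n + 1
    · have := congrFun hw ⟨k, hk⟩
      exact sub_eq_zero.mp ((Polynomial.coeff_sub _ _ _).symm.trans this)
    · rw [coeff_star_of_lt u a m n k hud le_rfl (by omega),
        coeff_star_of_lt v b n m k hvd le_rfl (by omega)]
  refine ⟨u, v, ?_, heq⟩
  rintro rfl
  have h0 : star v b = 0 := by rw [← heq]; exact map_zero (starRight a)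
  have hv0 : v ≠ 0 := by
    rintro rfl
    exact hne rfl
  have h1 := leadingCoeff_star hv0 hb
  rw [h0, Polynomial.leadingCoeff_zero, eq_comm, mul_eq_zero, Polynomial.leadingCoeff_eq_zero,
    Polynomial.leadingCoeff_eq_zero] at h1
  exact h1.elim hv0 hb

/-- The differential operators form an Ore domain. -/
theorem nonempty_oreSet : Nonempty (OreLocalization.OreSet DiffOp⁰) := by
  rw [OreLocalization.nonempty_oreSet_iff_of_noZeroDivisors]
  intro r s
  obtain ⟨u, v, hu, huv⟩ := exists_star_eq (symbol r) (symbol s)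
    (symbol_eq_zero.not.mpr (nonZeroDivisors.ne_zero s.2))
  have hu' : ofSymbol u ≠ 0 := by
    rw [Ne, ← symbol_eq_zero, symbol_ofSymbol]; exact hu
  refine ⟨ofSymbol v, ⟨ofSymbol u, mem_nonZeroDivisors_of_ne_zero hu'⟩, ?_⟩
  apply Subtype.ext
  change toEnd u * r.1 = toEnd v * s.1.1
  rw [← toEnd_symbol r, ← toEnd_symbol s.1, ← toEnd_star, ← toEnd_star, huv]

instance instOreSet : OreLocalization.OreSet DiffOp⁰ := Classical.choice nonempty_oreSet

end DiffOp

/-- Fractional differential operators: the skew field of fractions of the algebra of differential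
operators with coefficients in `ℂ[[x]]`. Its elements are the fractions `r /ₒ s = s⁻¹ r`. -/
abbrev FracDiffOp : Type := OreLocalization DiffOp⁰ DiffOp

namespace FracDiffOp

open Classical in
/-- The order of a fractional differential operator: `ord (s⁻¹ r) = ord r - ord s`,
and `ord 0 = -∞`. -/
def order : FracDiffOp → WithBot ℤ :=
  OreLocalization.liftExpand
    (fun r s => if r = 0 then ⊥ else (((r.order : ℤ) - (s : DiffOp).order : ℤ) : WithBot ℤ))
    (by
      intro r t s ht
      have hts := nonZeroDivisors.ne_zero ht
      have ht0 : t ≠ 0 := left_ne_zero_of_mul hts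
      by_cases hr : r = 0
      · simp [hr]
      · rw [if_neg hr, smul_eq_mul, if_neg (mul_ne_zero ht0 hr), DiffOp.order_mul ht0 hr,
          DiffOp.order_mul ht0 (right_ne_zero_of_mul hts)]
        push_cast
        rw [add_sub_add_left_eq_sub])

/-- The leading coefficient of a fractional differential operator, an element of `ℂ((x))`:
the leading coefficient of `s⁻¹ r` is the quotient of those of `r` and `s`. -/
def leadingCoeff : FracDiffOp → LaurentSeries ℂ :=
  OreLocalization.liftExpand
    (fun r s => algebraMap ℂ⟦X⟧ (LaurentSeries ℂ) r.leadingCoeff /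
      algebraMap ℂ⟦X⟧ (LaurentSeries ℂ) (s : DiffOp).leadingCoeff)
    (by
      intro r t s ht
      have ht0 : t ≠ 0 := left_ne_zero_of_mul (nonZeroDivisors.ne_zero ht)
      have h : algebraMap ℂ⟦X⟧ (LaurentSeries ℂ) t.leadingCoeff ≠ 0 := by
        rw [Ne, map_eq_zero_iff _ (IsFractionRing.injective ℂ⟦X⟧ (LaurentSeries ℂ)),
          DiffOp.leadingCoeff_eq_zero]
        exact ht0
      rw [smul_eq_mul, DiffOp.leadingCoeff_mul, DiffOp.leadingCoeff_mul, map_mul, map_mul,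
        mul_div_mul_left _ _ h])

/-- A fractional differential operator is monic if its leading coefficient is `1`. -/
def IsMonic (P : FracDiffOp) : Prop := P.leadingCoeff = 1

/-- The value `F(P, Q) = ∑ cᵢⱼ Pⁱ Qʲ` of a polynomial `F = ∑ cᵢⱼ zⁱ wʲ` at the pair `(P, Q)`. -/
def evalPair (F : MvPolynomial (Fin 2) ℂ) (P Q : FracDiffOp) : FracDiffOp :=
  ∑ m ∈ F.support, F.coeff m • (P ^ m 0 * Q ^ m 1)

/-- `P` and `Q` are algebraically dependent: `F(P, Q) = 0` for some nonzero polynomial `F` with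
complex coefficients. -/
def AlgDependent (P Q : FracDiffOp) : Prop :=
  ∃ F : MvPolynomial (Fin 2) ℂ, F ≠ 0 ∧ evalPair F P Q = 0

end FracDiffOp

end FracDiff

end

/-! Write `P = S⁻¹R`, `Q = V⁻¹U`, `r = ord R`, `s = ord S`, `K = ℂ((x))`. Adjoin a parameter `t`,
constant for `d/dx`, and let `∂` act on `K((t))` as `d/dx + t⁻¹ + h` with `h ∈ K[[t]]`: this is the
action on multiples of a formal exponential `exp ∫(t⁻¹ + h)dx`, which is represented by the vector
`1`. To lowest order in `t`, `∂ⁱ` acts as `t⁻ⁱ`, so every nonzero operator over `K` acts bijectively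
(`injective_op_map_C`, `surjective_op_map_C`). Hence fractions act as well, and a fraction that
kills `1` is zero.

Since `P` is monic and `r ≠ s`, successive approximation yields `h` with `P·1 = z`, where `z =
t^(s-r)` (`exists_riccati`). Rewritten in the plain derivation `d/dx`, the operator `R - zS` has no
constant term, and its lowest part in `t` is `c t^(1-r) ∂` with `c ≠ 0` (`lead_twist_sub`);
therefore it kills only constants of `d/dx`. As `Q` commutes with `P`, it kills `q = Q·1`, so `q ∈
ℂ((t))`. Now `F(P,Q)·1 = F(z,q)`, and it remains to see that `z` and `q` are algebraically dependent
over `ℂ`.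

If they were not, they would be independent over `K` too, so operators over `K[z,q]` could be
differentiated with respect to `q`. This derivation preserves the left ideal annihilating `1`
(`op_mapDer_eq_zero`): the ideal contains `R - zS`, which does not involve `q`, and whose left
factors, taken with a right factor that kills `1`, are injective. But `U - qV` kills `1`, while its
derivative `-V` does not (`not_injective_evalTwo`). -/

noncomputable section

namespace OreSymbol

open Polynomial

/-! ### Symbols of differential operators acting through a connection -/

section Operators

variable {k B M : Type*} [CommRing k] [CommRing B] [Algebra k B]
  [AddCommGroup M] [Module k M] [Module B M] [IsScalarTower k B M]

/-- The operator `∑ pᵢ Eⁱ` attached to a polynomial `∑ pᵢ Xⁱ` and an endomorphism `E`. -/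
def op (E : Module.End k M) : B[X] →ₗ[B] Module.End k M :=
  Polynomial.lsum fun i => LinearMap.toSpanSingleton B (Module.End k M) (E ^ i)

theorem op_eq_sum (E : Module.End k M) (p : B[X]) : op E p = p.sum fun i a => a • E ^ i := by
  simp [op, Polynomial.lsum_apply]

theorem op_monomial (E : Module.End k M) (i : ℕ) (a : B) :
    op E (monomial i a) = a • E ^ i := by
  simp [op, Polynomial.lsum_apply]

theorem op_apply (E : Module.End k M) (p : B[X]) (m : M) :
    op E p m = p.sum fun i a => a • (E ^ i) m := by
  rw [op_eq_sum, Polynomial.sum_def, Polynomial.sum_def, LinearMap.sum_apply]; rfl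

theorem op_apply_range (E : Module.End k M) (p : B[X]) (m : M) {N : ℕ} (hN : p.natDegree < N) :
    op E p m = ∑ i ∈ Finset.range N, p.coeff i • (E ^ i) m := by
  rw [op_apply, Polynomial.sum_over_range' _ _ _ hN]
  simp

theorem op_one (E : Module.End k M) : op E (1 : B[X]) = 1 := by
  have := op_monomial E 0 (1 : B)
  simpa using this

/-- Coefficientwise application of a linear map to a polynomial. -/
def mapLin {B' : Type*} [CommRing B'] [Module k B'] (d : B →ₗ[k] B') : B[X] →ₗ[k] B'[X] where
  toFun p := p.sum fun i a => monomial i (d a)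
  map_add' p q := Polynomial.sum_add_index p q _ (by simp) (by simp)
  map_smul' c p := by
    rw [Polynomial.sum_smul_index' _ _ _ (by simp), RingHom.id_apply, Polynomial.sum_def,
      Polynomial.sum_def, Finset.smul_sum]
    refine Finset.sum_congr rfl fun j _ => ?_
    rw [Polynomial.smul_monomial, map_smul]

theorem mapLin_monomial {B' : Type*} [CommRing B'] [Module k B'] (d : B →ₗ[k] B') (i : ℕ) (a : B) :
    mapLin d (monomial i a) = monomial i (d a) := by
  change (monomial i a).sum (fun i a => monomial i (d a)) = _
  rw [Polynomial.sum_monomial_index _ _ (by simp)]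

theorem coeff_mapLin {B' : Type*} [CommRing B'] [Module k B'] (d : B →ₗ[k] B') (p : B[X]) (n : ℕ) :
    (mapLin d p).coeff n = d (p.coeff n) := by
  induction p using Polynomial.induction_on' with
  | add p q hp hq => rw [map_add, coeff_add, hp, hq, coeff_add, map_add]
  | monomial i a =>
    rw [mapLin_monomial, coeff_monomial, coeff_monomial]
    split_ifs <;> simp

/-- A derivation, applied coefficientwise to polynomials. -/
def mapDer (d : Derivation k B B) : Derivation k B[X] B[X] :=
  Derivation.mk' (mapLin d.toLinearMap) fun p q => by
    induction p using Polynomial.induction_on' with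
    | add p p' hp hp' => simp only [add_mul, map_add, hp, hp', smul_eq_mul]; ring
    | monomial i a =>
      induction q using Polynomial.induction_on' with
      | add q q' hq hq' => simp only [mul_add, map_add, hq, hq', smul_eq_mul]; ring
      | monomial j b =>
        simp only [monomial_mul_monomial, mapLin_monomial, smul_eq_mul,
          Derivation.coeFn_coe, Derivation.leibniz, map_add]
        rw [add_comm j i]

@[simp] theorem coeff_mapDer (d : Derivation k B B) (p : B[X]) (n : ℕ) :
    (mapDer d p).coeff n = d (p.coeff n) := coeff_mapLin d.toLinearMap p n

@[simp] theorem mapDer_monomial (d : Derivation k B B) (i : ℕ) (a : B) :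
    mapDer d (monomial i a) = monomial i (d a) := mapLin_monomial d.toLinearMap i a

@[simp] theorem mapDer_X (d : Derivation k B B) : mapDer d (X : B[X]) = 0 := by
  rw [← monomial_one_one_eq_X, mapDer_monomial]; simp

@[simp] theorem mapDer_C (d : Derivation k B B) (a : B) : mapDer d (C a) = C (d a) := by
  rw [← monomial_zero_left, mapDer_monomial, monomial_zero_left]

variable (d : Derivation k B B)

/-- Left composition with `∂`, on symbols. -/
def nab : Module.End k B[X] := LinearMap.mulLeft k X + (mapDer d).toLinearMap

theorem nab_apply (q : B[X]) : nab d q = X * q + mapDer d q := rfl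

/-- `E` satisfies the Leibniz rule over `d`. -/
def IsConn (E : Module.End k M) : Prop := ∀ (a : B) (m : M), E (a • m) = a • E m + d a • m

theorem isConn_nab : IsConn d (nab d) := by
  intro a q
  simp only [nab_apply, smul_eq_C_mul, Derivation.leibniz, mapDer_C, smul_eq_mul]
  ring

variable {d}

theorem IsConn.add_smul {E : Module.End k M} (hE : IsConn d E) (g : B) :
    IsConn d (E + g • (1 : Module.End k M)) := by
  intro a m
  have := hE a m
  simp only [LinearMap.add_apply, LinearMap.smul_apply, Module.End.one_apply, this, smul_add,
    smul_comm g a]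
  abel

theorem op_nab {E : Module.End k M} (hE : IsConn d E) (q : B[X]) :
    op E (nab d q) = E * op E q := by
  induction q using Polynomial.induction_on' with
  | add p q hp hq => rw [map_add, map_add, map_add, mul_add, hp, hq]
  | monomial n a =>
    rw [nab_apply, X_mul_monomial, mapDer_monomial, map_add, op_monomial, op_monomial, op_monomial]
    ext1 m
    simp only [LinearMap.add_apply, LinearMap.smul_apply, Module.End.mul_apply, pow_succ']
    exact (hE _ _).symm

/-- Here `F` is left multiplication by `E'` seen on symbols. The choice `F = nab d` gives
composition, and `F = nab d + g` gives the substitution `∂ ↦ ∂ + g`. -/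
theorem op_op {E E' : Module.End k M} {F : Module.End k B[X]}
    (h : ∀ q, op E (F q) = E' * op E q) (p q : B[X]) :
    op E (op F p q) = op E' p * op E q := by
  have hpow : ∀ i, op E ((F ^ i) q) = E' ^ i * op E q := by
    intro i
    induction i with
    | zero => simp
    | succ i ih => rw [pow_succ', Module.End.mul_apply, h, ih, pow_succ', mul_assoc]
  rw [op_apply, op_eq_sum E', Polynomial.sum_def, Polynomial.sum_def, map_sum, Finset.sum_mul]
  refine Finset.sum_congr rfl fun i _ => ?_
  rw [map_smul, hpow]
  ext1 m
  rfl

variable (d)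

/-- Composition of differential operators, on symbols. -/
def star (p q : B[X]) : B[X] := op (nab d) p q

variable {d}

theorem op_star {E : Module.End k M} (hE : IsConn d E) (p q : B[X]) :
    op E (star d p q) = op E p * op E q := op_op (op_nab hE) p q

theorem nab_pow_one (i : ℕ) : (nab d ^ i) (1 : B[X]) = X ^ i := by
  induction i with
  | zero => simp
  | succ i ih =>
    rw [pow_succ', Module.End.mul_apply, ih, nab_apply, pow_succ']
    simp [Derivation.leibniz_pow]

variable (d)

/-- Conversion of a symbol in powers of `∂ + g` into a symbol in powers of `∂`. -/
def twist (g : B) (p : B[X]) : B[X] := op (nab d + g • (1 : Module.End k B[X])) p 1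

variable {d}

theorem op_op_twist {E : Module.End k M} (hE : IsConn d E) (g : B) (p q : B[X]) :
    op E (op (nab d + g • (1 : Module.End k B[X])) p q) =
      op (E + g • (1 : Module.End k M)) p * op E q := by
  refine op_op (fun q => ?_) p q
  rw [LinearMap.add_apply, map_add, op_nab hE, add_mul, LinearMap.smul_apply, map_smul]
  ext1 m
  rfl

theorem op_twist {E : Module.End k M} (hE : IsConn d E) (g : B) (p : B[X]) :
    op E (twist d g p) = op (E + g • (1 : Module.End k M)) p := by
  rw [twist, op_op_twist hE, op_one, mul_one]

/-- The substitution `∂ ↦ ∂ + g` respects composition: `nab d + g` is itself a connection on `B[X]`,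
so `op_star` applies to it, and symbols are recovered by evaluating at `1`. -/
theorem twist_star (g : B) (p q : B[X]) :
    twist d g (star d p q) = star d (twist d g p) (twist d g q) := by
  have h := op_star ((isConn_nab d).add_smul g) p q
  rw [twist, h, Module.End.mul_apply, star, op_twist (isConn_nab d)]
  rfl

theorem twist_smul (g a : B) (p : B[X]) : twist d g (a • p) = a • twist d g p := by
  simp [twist]

end Operators

/-! ### Degrees and leading coefficients of compositions -/

section Degree

variable {k B : Type*} [CommRing k] [CommRing B] [Algebra k B] {d : Derivation k B B}

theorem coeff_nab_pow_of_lt (i : ℕ) (q : B[X]) (n m : ℕ) (hq : q.natDegree ≤ n)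
    (hm : i + n < m) : ((nab d ^ i) q).coeff m = 0 := by
  induction i generalizing m with
  | zero => simpa using Polynomial.coeff_eq_zero_of_natDegree_lt (by omega)
  | succ i ih =>
    rw [pow_succ', Module.End.mul_apply, nab_apply, coeff_add, coeff_mapDer, ih m (by omega)]
    obtain ⟨j, rfl⟩ : ∃ j, m = j + 1 := ⟨m - 1, by omega⟩
    rw [Polynomial.coeff_X_mul, ih j (by omega), map_zero, add_zero]

theorem coeff_nab_pow_top (i : ℕ) (q : B[X]) (n : ℕ) (hq : q.natDegree ≤ n) :
    ((nab d ^ i) q).coeff (i + n) = q.coeff n := by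
  induction i with
  | zero => simp
  | succ i ih =>
    rw [pow_succ', Module.End.mul_apply, nab_apply, coeff_add, coeff_mapDer,
      show i + 1 + n = (i + n) + 1 by ring, Polynomial.coeff_X_mul, ih,
      coeff_nab_pow_of_lt i q n _ hq (by omega), map_zero, add_zero]

theorem coeff_star_top (p q : B[X]) :
    (star d p q).coeff (p.natDegree + q.natDegree) = p.leadingCoeff * q.leadingCoeff := by
  rw [star, op_apply, Polynomial.sum_def, Polynomial.finsetSum_coeff,
    Finset.sum_eq_single p.natDegree]
  · rw [Polynomial.coeff_smul, coeff_nab_pow_top _ _ _ le_rfl]; rfl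
  · intro i hi hne
    have := Polynomial.le_natDegree_of_mem_supp i hi
    rw [Polynomial.coeff_smul, coeff_nab_pow_of_lt i q _ _ le_rfl (by omega), smul_zero]
  · intro h
    rw [Polynomial.notMem_support_iff.mp h, zero_smul, Polynomial.coeff_zero]

variable [IsDomain B]

theorem coeff_star_top_ne_zero {p q : B[X]} (hp : p ≠ 0) (hq : q ≠ 0) :
    (star d p q).coeff (p.natDegree + q.natDegree) ≠ 0 := by
  rw [coeff_star_top]
  exact mul_ne_zero (leadingCoeff_ne_zero.mpr hp) (leadingCoeff_ne_zero.mpr hq)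

theorem star_ne_zero {p q : B[X]} (hp : p ≠ 0) (hq : q ≠ 0) : star d p q ≠ 0 := by
  intro h
  have := coeff_star_top_ne_zero (d := d) hp hq
  rw [h, coeff_zero] at this
  exact this rfl

end Degree

/-! ### Change of the coefficient ring -/

section Naturality

variable {k B B' M M' : Type*} [CommRing k] [CommRing B] [Algebra k B] [CommRing B'] [Algebra k B']
  [AddCommGroup M] [Module k M] [Module B M] [IsScalarTower k B M]
  [AddCommGroup M'] [Module k M'] [Module B' M'] [IsScalarTower k B' M']

theorem map_op {E : Module.End k M} {E' : Module.End k M'} (e : B →+* B') (f : M →+ M')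
    (hf : ∀ (a : B) m, f (a • m) = e a • f m) (hE : ∀ m, f (E m) = E' (f m))
    (p : B[X]) (m : M) : f (op E p m) = op E' (p.map e) (f m) := by
  have hpow : ∀ i, f ((E ^ i) m) = (E' ^ i) (f m) := by
    intro i
    induction i with
    | zero => simp
    | succ i ih => rw [pow_succ', Module.End.mul_apply, hE, ih, pow_succ', Module.End.mul_apply]
  induction p using Polynomial.induction_on' with
  | add p q hp hq =>
    rw [map_add, LinearMap.add_apply, map_add, hp, hq, Polynomial.map_add, map_add,
      LinearMap.add_apply]
  | monomial i a =>
    rw [op_monomial, Polynomial.map_monomial, op_monomial, LinearMap.smul_apply, hf, hpow,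
      LinearMap.smul_apply]

theorem map_star {d : Derivation k B B} {d' : Derivation k B' B'} (e : B →+* B')
    (he : ∀ a, e (d a) = d' (e a)) (p q : B[X]) :
    (star d p q).map e = star d' (p.map e) (q.map e) := by
  refine map_op e (Polynomial.mapRingHom e).toAddMonoidHom (fun a m => ?_) (fun m => ?_) p q
  · simp [smul_eq_C_mul]
  · ext n
    simp only [nab_apply, RingHom.toAddMonoidHom_eq_coe, AddMonoidHom.coe_coe, coe_mapRingHom,
      Polynomial.map_add, Polynomial.map_mul, map_X, coeff_add, coeff_map, coeff_mapDer, he]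

end Naturality

/-- Coefficientwise scalar multiplication on Laurent series over a `k`-algebra. -/
local instance (priority := 2000) instAlgebraSeries {k K : Type*} [Field k] [Field K]
    [Algebra k K] : Algebra k (LaurentSeries K) :=
  HahnSeries.instAlgebra

/-! ### The `t`-adic filtration on Laurent series -/

section Series

variable {K : Type*} [Field K]

/-- The Laurent series `φ` has only terms of degree at least `m`. -/
def Van (m : ℤ) (φ : LaurentSeries K) : Prop := ∀ i < m, φ.coeff i = 0

theorem Van.mono {m n : ℤ} {φ : LaurentSeries K} (h : Van m φ) (hn : n ≤ m) : Van n φ :=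
  fun i hi => h i (by omega)

theorem van_zero (m : ℤ) : Van m (0 : LaurentSeries K) := fun _ _ => rfl

theorem Van.add {m : ℤ} {φ ψ : LaurentSeries K} (h : Van m φ) (h' : Van m ψ) : Van m (φ + ψ) :=
  fun i hi => by rw [HahnSeries.coeff_add, h i hi, h' i hi, add_zero]

theorem Van.sub {m : ℤ} {φ ψ : LaurentSeries K} (h : Van m φ) (h' : Van m ψ) : Van m (φ - ψ) :=
  fun i hi => by rw [HahnSeries.coeff_sub, h i hi, h' i hi, sub_zero]

theorem Van.neg {m : ℤ} {φ : LaurentSeries K} (h : Van m φ) : Van m (-φ) :=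
  fun i hi => by rw [HahnSeries.coeff_neg, h i hi, neg_zero]

theorem Van.sum {ι : Type*} {m : ℤ} {s : Finset ι} {φ : ι → LaurentSeries K}
    (h : ∀ i ∈ s, Van m (φ i)) : Van m (∑ i ∈ s, φ i) :=
  fun j hj => by
    rw [HahnSeries.coeff_sum]
    exact Finset.sum_eq_zero fun i hi => h i hi j hj

theorem Van.mul {m n : ℤ} {φ ψ : LaurentSeries K} (h : Van m φ) (h' : Van n ψ) :
    Van (m + n) (φ * ψ) := fun i hi => by
  rw [HahnSeries.coeff_mul]
  refine Finset.sum_eq_zero fun p hp => ?_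
  rw [Finset.mem_antidiagonal] at hp
  rcases lt_or_ge p.1 m with h1 | h1
  · rw [h _ h1, zero_mul]
  · rw [h' p.2 (by omega), mul_zero]

theorem Van.coeff_mul {m n : ℤ} {φ ψ : LaurentSeries K} (h : Van m φ) (h' : Van n ψ) :
    (φ * ψ).coeff (m + n) = φ.coeff m * ψ.coeff n := by
  rw [HahnSeries.coeff_mul, Finset.sum_eq_single (m, n)]
  · intro p hp hne
    rw [Finset.mem_antidiagonal] at hp
    rcases lt_trichotomy p.1 m with h1 | h1 | h1
    · rw [h _ h1, zero_mul]
    · exact absurd (Prod.ext h1 (by omega)) hne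
    · rw [h' p.2 (by omega), mul_zero]
  · intro hp
    rw [Finset.mem_antidiagonal] at hp
    by_contra hne
    exact hp ⟨left_ne_zero_of_mul hne, right_ne_zero_of_mul hne, rfl⟩

theorem van_C (a : K) : Van 0 (HahnSeries.C a : LaurentSeries K) := fun _ hi =>
  HahnSeries.coeff_single_of_ne hi.ne

theorem Van.C_mul {m : ℤ} {φ : LaurentSeries K} (h : Van m φ) (a : K) :
    Van m (HahnSeries.C a * φ) := by
  simpa using (van_C a).mul h

variable (K) in
/-- The monomial of degree `j`. -/
def T (j : ℤ) : LaurentSeries K := HahnSeries.single j 1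

theorem T_mul_T (i j : ℤ) : T K i * T K j = T K (i + j) := by
  simp [T, HahnSeries.single_mul_single]

theorem T_zero : T K 0 = 1 := rfl

theorem T_ne_zero (j : ℤ) : T K j ≠ 0 := HahnSeries.single_ne_zero one_ne_zero

theorem van_T (j : ℤ) : Van j (T K j) := fun _ hi => HahnSeries.coeff_single_of_ne hi.ne

theorem coeff_T_self (j : ℤ) : (T K j).coeff j = 1 := HahnSeries.coeff_single_same _ _

theorem Van.T_mul {m n j : ℤ} {φ : LaurentSeries K} (h : Van m φ) (hn : n = j + m) :
    Van n (T K j * φ) := by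
  subst hn
  exact (van_T j).mul h

theorem eq_zero_of_forall_van {φ : LaurentSeries K} {m : ℤ} (h : ∀ n : ℕ, Van (m + n) φ) :
    φ = 0 := by
  ext i
  exact h (i - m + 1).toNat i (by omega)

theorem exists_van_coeff_ne_zero {φ : LaurentSeries K} (h : φ ≠ 0) :
    ∃ m, Van m φ ∧ φ.coeff m ≠ 0 :=
  ⟨φ.order, fun _ hi => HahnSeries.coeff_eq_zero_of_lt_order hi,
    fun h0 => h (HahnSeries.coeff_order_eq_zero.mp h0)⟩

/-- A contraction of the space of Laurent series has a fixed point. -/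
theorem exists_fixed_point (f : LaurentSeries K → LaurentSeries K) (m₀ : ℤ) (h0 : Van m₀ (f 0))
    (hf : ∀ m, m₀ ≤ m → ∀ a b, Van m₀ a → Van m₀ b → Van m (a - b) → Van (m + 1) (f a - f b)) :
    ∃ h, Van m₀ h ∧ f h = h := by
  have hV : ∀ j : ℕ, Van m₀ (f^[j] 0) := by
    intro j
    induction j with
    | zero => exact van_zero _
    | succ j ih =>
      rw [Function.iterate_succ_apply']
      have := ((hf m₀ le_rfl _ _ ih (van_zero _) (by simpa using ih)).mono
        (show m₀ ≤ m₀ + 1 by omega)).add h0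
      simpa using this
  have hstep : ∀ j : ℕ, Van (m₀ + j) (f^[j + 1] 0 - f^[j] 0) := by
    intro j
    induction j with
    | zero => simpa using h0
    | succ j ih =>
      rw [Function.iterate_succ_apply' f (j + 1), Function.iterate_succ_apply' f j]
      have := hf (m₀ + j) (by omega) _ _ (hV (j + 1)) (hV j) ih
      rw [Function.iterate_succ_apply' f j] at this
      exact this.mono (by push_cast; omega)
  have hdiff : ∀ i l : ℕ, Van (m₀ + i) (f^[i + l] 0 - f^[i] 0) := by
    intro i l
    induction l with
    | zero => simpa using van_zero _
    | succ l ih =>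
      have := ((hstep (i + l)).mono (show m₀ + i ≤ m₀ + (i + l : ℕ) by push_cast; omega)).add ih
      simpa [← add_assoc] using this
  -- By `hdiff`, the coefficient of degree `n` no longer changes from the iterate `n - m₀ + 1` on.
  let h : LaurentSeries K := HahnSeries.ofSuppBddBelow
    (fun n => if n < m₀ then 0 else (f^[(n - m₀).toNat + 1] 0).coeff n)
    ⟨m₀, fun n hn => not_lt.mp fun hlt => hn (if_pos hlt)⟩
  have hcoeff : ∀ n, h.coeff n = if n < m₀ then 0 else (f^[(n - m₀).toNat + 1] 0).coeff n :=
    fun n => rfl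
  have hh : Van m₀ h := fun n hn => by rw [hcoeff, if_pos hn]
  have happ : ∀ j : ℕ, Van (m₀ + j) (h - f^[j] 0) := by
    intro j n hn
    rw [HahnSeries.coeff_sub, hcoeff]
    split_ifs with hlt
    · rw [hV j n hlt, sub_zero]
    · obtain ⟨l, hl⟩ : ∃ l, j = (n - m₀).toNat + 1 + l := ⟨j - ((n - m₀).toNat + 1), by omega⟩
      have := hdiff ((n - m₀).toNat + 1) l n (by push_cast; omega)
      rw [HahnSeries.coeff_sub, sub_eq_zero, ← hl] at this
      rw [this, sub_self]
  refine ⟨h, hh, sub_eq_zero.mp (eq_zero_of_forall_van (m := m₀) fun j => ?_)⟩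
  have h1 := hf (m₀ + j) (by omega) _ _ hh (hV j) (happ j)
  have h2 := happ (j + 1)
  rw [← Function.iterate_succ_apply' f j] at h1
  have h3 := (h1.mono (show m₀ + j ≤ m₀ + j + 1 by omega)).sub
    (h2.mono (show m₀ + j ≤ m₀ + (j + 1 : ℕ) by push_cast; omega))
  simpa using h3

end Series

/-! ### Coefficientwise derivation of Laurent series -/

section Derivation

variable {k K : Type*} [Field k] [Field K] [Algebra k K]

variable (D : Derivation k K K)

/-- A derivation, applied coefficientwise to Laurent series. -/
def serDer : Derivation k (LaurentSeries K) (LaurentSeries K) :=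
  Derivation.mk'
    { toFun := fun φ => φ.map D
      map_add' := fun φ ψ => by ext; simp
      map_smul' := fun c φ => by ext; simp }
    fun φ ψ => by
      ext n
      change D ((φ * ψ).coeff n) = (φ * ψ.map D + ψ * φ.map D).coeff n
      -- This lets all three products be summed over the same index set, so that Leibniz can be
      -- applied term by term.
      have hs : ∀ χ : LaurentSeries K, (χ.map D).support ⊆ χ.support := by
        intro χ i hi h0
        apply hi
        change D (χ.coeff i) = 0
        rw [h0, map_zero]
      rw [HahnSeries.coeff_add, mul_comm ψ, HahnSeries.coeff_mul_right' (y := ψ.map D)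
        ψ.isPWO_support (hs ψ), HahnSeries.coeff_mul_left' (x := φ.map D) φ.isPWO_support (hs φ),
        HahnSeries.coeff_mul, map_sum, ← Finset.sum_add_distrib]
      refine Finset.sum_congr rfl fun p _ => ?_
      rw [Derivation.leibniz, smul_eq_mul, smul_eq_mul, mul_comm (ψ.coeff _)]
      rfl

@[simp] theorem coeff_serDer (φ : LaurentSeries K) (n : ℤ) :
    (serDer D φ).coeff n = D (φ.coeff n) := rfl

@[simp] theorem serDer_C (a : K) : serDer D (HahnSeries.C a) = HahnSeries.C (D a) := by
  ext n
  rw [coeff_serDer, HahnSeries.C_apply, HahnSeries.C_apply, HahnSeries.coeff_single,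
    HahnSeries.coeff_single]
  split_ifs <;> simp

@[simp] theorem serDer_T (j : ℤ) : serDer D (T K j) = 0 := by
  ext n
  rw [coeff_serDer, T, HahnSeries.coeff_single]
  split_ifs <;> simp

variable {D}

theorem Van.serDer {m : ℤ} {φ : LaurentSeries K} (h : Van m φ) : Van m (serDer D φ) :=
  fun i hi => by rw [coeff_serDer, h i hi, map_zero]

end Derivation

/-! ### Lowest parts in `t` of operators, and injectivity of factors -/

section Leading

variable {k K : Type*} [Field k] [Field K] [Algebra k K]

/-- All coefficients of `p` have only terms of degree at least `m`. -/
def PVan (m : ℤ) (p : (LaurentSeries K)[X]) : Prop := ∀ n, Van m (p.coeff n)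

variable (K) in
/-- The polynomial of coefficients of degree `m` of a polynomial over the Laurent series. -/
def lead (m : ℤ) : (LaurentSeries K)[X] →ₗ[K] K[X] := mapLin (HahnSeries.coeff.linearMap m)

@[simp] theorem coeff_lead (m : ℤ) (p : (LaurentSeries K)[X]) (n : ℕ) :
    (lead K m p).coeff n = (p.coeff n).coeff m := coeff_mapLin _ p n

theorem natDegree_lead_le (m : ℤ) (p : (LaurentSeries K)[X]) :
    (lead K m p).natDegree ≤ p.natDegree := by
  rw [natDegree_le_iff_coeff_eq_zero]
  intro n hn
  rw [coeff_lead, coeff_eq_zero_of_natDegree_lt hn, HahnSeries.coeff_zero]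

theorem exists_pVan_lead_ne_zero {p : (LaurentSeries K)[X]} (hp : p ≠ 0) :
    ∃ m, PVan m p ∧ lead K m p ≠ 0 := by
  obtain ⟨i, hi, hmin⟩ := Finset.exists_min_image p.support (fun i => (p.coeff i).order)
    (nonempty_support_iff.mpr hp)
  refine ⟨(p.coeff i).order, fun n j hj => ?_, fun h => ?_⟩
  · by_cases hn : n ∈ p.support
    · exact HahnSeries.coeff_eq_zero_of_lt_order (hj.trans_le (hmin n hn))
    · rw [notMem_support_iff.mp hn, HahnSeries.coeff_zero]
  · have := congrArg (fun q => q.coeff i) h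
    simp only [coeff_lead, coeff_zero, HahnSeries.coeff_order_eq_zero] at this
    exact mem_support_iff.mp hi this

theorem PVan.lead_eq_zero {m n : ℤ} {p : (LaurentSeries K)[X]} (h : PVan m p) (hn : n < m) :
    lead K n p = 0 := by
  ext i
  rw [coeff_lead, h i n hn, coeff_zero]

variable {D : Derivation k K K}

/-- As `t` is a constant of the derivation, composition with `∂` respects the grading by powers of
`t`. -/
theorem PVan.nab_pow {n : ℤ} {q : (LaurentSeries K)[X]} (h : PVan n q) (i : ℕ) :
    PVan n ((nab (serDer D) ^ i) q) ∧
      lead K n ((nab (serDer D) ^ i) q) = (nab D ^ i) (lead K n q) := by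
  induction i with
  | zero => exact ⟨h, rfl⟩
  | succ i ih =>
    obtain ⟨h1, h2⟩ := ih
    rw [pow_succ', Module.End.mul_apply, pow_succ', Module.End.mul_apply, ← h2]
    refine ⟨fun j => ?_, ?_⟩
    · rw [nab_apply, coeff_add, coeff_mapDer]
      refine Van.add ?_ (h1 j).serDer
      cases j with
      | zero => simpa using van_zero n
      | succ j => simpa using h1 j
    · ext j
      rw [coeff_lead, nab_apply, nab_apply, coeff_add, coeff_mapDer, coeff_add, coeff_mapDer,
        HahnSeries.coeff_add, coeff_serDer, coeff_lead]
      cases j with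
      | zero => simp
      | succ j => simp

theorem PVan.star {m n : ℤ} {p q : (LaurentSeries K)[X]} (hp : PVan m p) (hq : PVan n q) :
    PVan (m + n) (star (serDer D) p q) ∧
      lead K (m + n) (OreSymbol.star (serDer D) p q) =
        OreSymbol.star D (lead K m p) (lead K n q) := by
  unfold OreSymbol.star
  rw [op_apply_range _ p q (Nat.lt_succ_self _),
    op_apply_range _ (lead K m p) _ (Nat.lt_succ_of_le (natDegree_lead_le m p))]
  constructor
  · intro j
    rw [finsetSum_coeff]
    refine Van.sum fun i _ => ?_
    rw [coeff_smul, smul_eq_mul]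
    exact (hp i).mul ((hq.nab_pow i).1 j)
  · ext j
    rw [coeff_lead, finsetSum_coeff, finsetSum_coeff, HahnSeries.coeff_sum]
    refine Finset.sum_congr rfl fun i _ => ?_
    rw [coeff_smul, coeff_smul, smul_eq_mul, smul_eq_mul, (hp i).coeff_mul ((hq.nab_pow i).1 j),
      ← (hq.nab_pow (D := D) i).2, coeff_lead, coeff_lead]

theorem Van.serDer_pow {m : ℤ} {φ : LaurentSeries K} (h : Van m φ) (i : ℕ) :
    Van m (((OreSymbol.serDer D).toLinearMap ^ i) φ) := by
  induction i with
  | zero => exact h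
  | succ i ih =>
    rw [pow_succ', Module.End.mul_apply]
    exact ih.serDer

/-- A left factor of an operator with leading symbol `c ∂`, whose right factor kills `1`, is
injective. -/
theorem injective_op_of_star {A G : (LaurentSeries K)[X]} {w : ℤ} {c : K} (hc : c ≠ 0)
    (hW : PVan w (star (serDer D) A G))
    (hlead : lead K w (star (serDer D) A G) = C c * X) (hG : G.coeff 0 = 0)
    {φ : LaurentSeries K} (hφ : op (serDer D).toLinearMap A φ = 0) : φ = 0 := by
  have hcX : (C c * X : K[X]) ≠ 0 := mul_ne_zero (C_ne_zero.mpr hc) X_ne_zero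
  have hne : star (serDer D) A G ≠ 0 := by
    intro h
    rw [h, map_zero] at hlead
    exact hcX hlead.symm
  have hA0 : A ≠ 0 := by
    rintro rfl
    exact hne (by simp [star])
  have hG0 : G ≠ 0 := by
    rintro rfl
    exact hne (by simp [star])
  obtain ⟨m, hm, hm0⟩ := exists_pVan_lead_ne_zero hA0
  obtain ⟨n, hn, hn0⟩ := exists_pVan_lead_ne_zero hG0
  obtain ⟨h1, h2⟩ := PVan.star (D := D) hm hn
  -- The lowest parts of `A` and `G` compose to something nonzero, so this composite is the lowest
  -- part of the product, namely `c ∂`.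
  have hstar := star_ne_zero (d := D) hm0 hn0
  have hmn : m + n = w := by
    rcases lt_trichotomy (m + n) w with h | h | h
    · exact absurd (h2.symm.trans (hW.lead_eq_zero h)) hstar
    · exact h
    · exact absurd (hlead.symm.trans (h1.lead_eq_zero h)) hcX
  rw [hmn, hlead] at h2
  have hdeg : (lead K m A).natDegree + (lead K n G).natDegree ≤ 1 := by
    by_contra hlt
    refine coeff_star_top_ne_zero (d := D) hm0 hn0 ?_
    rw [← h2]
    refine coeff_eq_zero_of_natDegree_lt ((natDegree_C_mul_le c X).trans_lt ?_)
    rw [natDegree_X]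
    omega
  -- Without a constant term, the lowest part of `G` already uses up the order `1` of `c ∂`; the
  -- lowest part of `A` is then a nonzero scalar, and `A` cannot cancel the lowest term of a series.
  have hdegG : (lead K n G).natDegree ≠ 0 := by
    intro h
    rw [natDegree_eq_zero] at h
    obtain ⟨x, hx⟩ := h
    have : (lead K n G).coeff 0 = 0 := by rw [coeff_lead, hG, HahnSeries.coeff_zero]
    rw [← hx, coeff_C_zero] at this
    rw [this, C_0] at hx
    exact hn0 hx.symm
  have hcoeff : ∀ i, i ≠ 0 → (A.coeff i).coeff m = 0 := by
    intro i hi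
    rw [← coeff_lead]
    exact coeff_eq_zero_of_natDegree_lt (by omega)
  have hcoeff0 : (A.coeff 0).coeff m ≠ 0 := by
    intro h
    apply hm0
    ext i
    rw [coeff_lead, coeff_zero]
    by_cases hi : i = 0
    · rw [hi, h]
    · exact hcoeff i hi
  by_contra hφ0
  obtain ⟨l, hl, hl0⟩ := exists_van_coeff_ne_zero hφ0
  have := congrArg (fun ψ => HahnSeries.coeff ψ (m + l)) hφ
  simp only [op_apply_range _ A φ (Nat.lt_succ_self _), HahnSeries.coeff_sum,
    HahnSeries.coeff_zero] at this
  rw [Finset.sum_eq_single 0] at this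
  · rw [smul_eq_mul, (hm 0).coeff_mul (hl.serDer_pow 0)] at this
    exact mul_ne_zero hcoeff0 hl0 this
  · intro i _ hi
    rw [smul_eq_mul, (hm i).coeff_mul (hl.serDer_pow i), hcoeff i hi, zero_mul]
  · intro h
    simp at h

end Leading

/-! ### The formal eigenfunction and the bijectivity of operators -/

section Riccati

variable {k K : Type*} [Field k] [Field K] [Algebra k K]

/-- A polynomial over `K` as a polynomial over the Laurent series. -/
abbrev mapC (p : K[X]) : (LaurentSeries K)[X] := p.map (HahnSeries.C : K →+* LaurentSeries K)

variable (D : Derivation k K K)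

theorem isConn_serDer : IsConn (serDer D) (serDer D).toLinearMap := by
  intro a φ
  change serDer D (a * φ) = a * serDer D φ + serDer D a * φ
  rw [Derivation.leibniz, smul_eq_mul, smul_eq_mul, mul_comm φ]

/-- The connection `∂ + t⁻¹ + h` on Laurent series in `t`. -/
def conn (h : LaurentSeries K) : Module.End k (LaurentSeries K) :=
  (serDer D).toLinearMap + (T K (-1) + h) • (1 : Module.End k (LaurentSeries K))

theorem isConn_conn (h : LaurentSeries K) : IsConn (serDer D) (conn D h) :=
  (isConn_serDer D).add_smul _

variable {D}

theorem conn_apply (h φ : LaurentSeries K) :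
    conn D h φ = serDer D φ + (T K (-1) + h) * φ := rfl

theorem conn_pow_succ (h φ : LaurentSeries K) (i : ℕ) :
    (conn D h ^ (i + 1)) φ =
      serDer D ((conn D h ^ i) φ) + (T K (-1) + h) * (conn D h ^ i) φ := by
  rw [pow_succ', Module.End.mul_apply, conn_apply]

theorem conn_mul_of_const {h c : LaurentSeries K} (hc : serDer D c = 0) (φ : LaurentSeries K) :
    conn D h (c * φ) = c * conn D h φ := by
  have := isConn_conn D h c φ
  rwa [hc, zero_smul, add_zero] at this

/-- Constants of the derivation, such as powers of `t`, commute with all operators; eigenvalues of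
this kind can be moved through them. -/
theorem op_conn_mul_of_const {h c : LaurentSeries K} (hc : serDer D c = 0)
    (p : (LaurentSeries K)[X]) (φ : LaurentSeries K) :
    op (conn D h) p (c * φ) = c * op (conn D h) p φ := by
  have hpow : ∀ i, (conn D h ^ i) (c * φ) = c * (conn D h ^ i) φ := by
    intro i
    induction i with
    | zero => rfl
    | succ i ih =>
      rw [pow_succ', Module.End.mul_apply, ih, conn_mul_of_const hc, Module.End.mul_apply]
  rw [op_apply_range _ _ _ (Nat.lt_succ_self _), op_apply_range _ _ _ (Nat.lt_succ_self _),
    Finset.mul_sum]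
  refine Finset.sum_congr rfl fun i _ => ?_
  rw [hpow, smul_eq_mul, smul_eq_mul, mul_left_comm]

/-- Of the three summands of the connection only `t⁻¹` lowers the degree in `t`. -/
theorem Van.conn_pow {h φ : LaurentSeries K} {m : ℤ} (hφ : Van m φ) (hh : Van 0 h) (i : ℕ) :
    Van (m - i) ((conn D h ^ i) φ) ∧ Van (m + 1 - i) ((conn D h ^ i) φ - T K (-i) * φ) := by
  induction i with
  | zero => simpa [T_zero] using ⟨hφ, van_zero _⟩
  | succ i ih =>
    obtain ⟨h1, h2⟩ := ih
    rw [conn_pow_succ]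
    refine ⟨(h1.serDer.mono (by push_cast; omega)).add
      ((((van_T (-1)).add (hh.mono (by omega))).mul h1).mono (by push_cast; omega)), ?_⟩
    have e : OreSymbol.serDer D ((conn D h ^ i) φ) + (T K (-1) + h) * (conn D h ^ i) φ -
        T K (-(i + 1 : ℕ)) * φ = OreSymbol.serDer D ((conn D h ^ i) φ) + h * (conn D h ^ i) φ +
          T K (-1) * ((conn D h ^ i) φ - T K (-i) * φ) := by
      rw [show (-(i + 1 : ℕ) : ℤ) = -1 + -i by push_cast; ring, ← T_mul_T]
      ring
    rw [e]
    refine ((h1.serDer.mono ?_).add ((hh.mul h1).mono ?_)).add ((h2.T_mul rfl).mono ?_)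
    all_goals push_cast; omega

/-- Used to discard all but the top-order term of an operator: each drop in order gains a power of
`t`. -/
theorem van_sum_sub (c : ℕ → K) (u : ℕ → LaurentSeries K) (b : ℤ) (hu : ∀ i : ℕ, Van (b - i) (u i))
    (r : ℕ) : Van (b + 1 - r)
      (∑ i ∈ Finset.range (r + 1), HahnSeries.C (c i) * u i - HahnSeries.C (c r) * u r) := by
  rw [Finset.sum_range_succ, add_sub_cancel_right]
  refine Van.sum fun i hi => ?_
  have := Finset.mem_range.mp hi
  exact ((hu i).mono (by omega)).C_mul _

theorem op_map_C_apply (h φ : LaurentSeries K) (p : K[X]) :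
    op (conn D h) (mapC p) φ =
      ∑ i ∈ Finset.range (p.natDegree + 1), HahnSeries.C (p.coeff i) * (conn D h ^ i) φ := by
  rw [op_apply_range _ _ _ (Nat.lt_succ_of_le natDegree_map_le)]
  simp only [coeff_map, smul_eq_mul]

theorem Van.op_map_C {h φ : LaurentSeries K} {m : ℤ} (hφ : Van m φ) (hh : Van 0 h) (p : K[X]) :
    Van (m + 1 - p.natDegree) (op (conn D h) (mapC p) φ -
      HahnSeries.C p.leadingCoeff * (T K (-p.natDegree) * φ)) := by
  rw [op_map_C_apply]
  have h1 := van_sum_sub p.coeff (fun i => (conn D h ^ i) φ) m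
    (fun i => (hφ.conn_pow (D := D) hh i).1) p.natDegree
  have h2 := (hφ.conn_pow (D := D) hh p.natDegree).2.C_mul p.leadingCoeff
  convert h1.add h2 using 1
  rw [coeff_natDegree]
  ring

theorem injective_op_map_C {h : LaurentSeries K} (hh : Van 0 h) {p : K[X]} (hp : p ≠ 0) :
    Function.Injective (op (conn D h) (mapC p)) := by
  rw [injective_iff_map_eq_zero]
  intro φ hφ
  by_contra h0
  obtain ⟨m, hm, hm0⟩ := exists_van_coeff_ne_zero h0
  have := (hm.op_map_C (D := D) hh p) (-p.natDegree + m) (by omega)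
  rw [hφ, zero_sub, HahnSeries.coeff_neg, neg_eq_zero, HahnSeries.C_mul_eq_smul,
    HahnSeries.coeff_smul, (van_T _).coeff_mul hm, coeff_T_self, one_mul, smul_eq_mul] at this
  exact mul_ne_zero (leadingCoeff_ne_zero.mpr hp) hm0 this

theorem C_mul_C_inv {a : K} (ha : a ≠ 0) :
    (HahnSeries.C a * HahnSeries.C a⁻¹ : LaurentSeries K) = 1 := by
  rw [← map_mul, mul_inv_cancel₀ ha, map_one]

/-- By `Van.op_map_C` the operator is `a t^(-s)` to lowest order. Adding `a⁻¹ t^s` times the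
residual to an approximate preimage is therefore a contraction. -/
theorem surjective_op_map_C {h : LaurentSeries K} (hh : Van 0 h) {p : K[X]} (hp : p ≠ 0) :
    Function.Surjective (op (conn D h) (mapC p)) := by
  intro ψ
  obtain ⟨m, hm⟩ : ∃ m, Van m ψ := ⟨ψ.order, fun _ hi => HahnSeries.coeff_eq_zero_of_lt_order hi⟩
  set a := p.leadingCoeff with ha
  have ha0 : a ≠ 0 := leadingCoeff_ne_zero.mpr hp
  set s := p.natDegree with hs
  set S := op (conn D h) (mapC p) with hS
  obtain ⟨φ, -, hφ⟩ := exists_fixed_point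
    (fun φ => φ + HahnSeries.C a⁻¹ * (T K s * (ψ - S φ))) (m + s) (by
      simp only [map_zero, sub_zero, zero_add]
      exact (hm.T_mul (by omega)).C_mul _) (by
      intro n _ x y _ _ hxy
      have h1 := ((hxy.op_map_C (D := D) hh p).T_mul (j := s) (n := n + 1)
        (by omega)).C_mul a⁻¹
      have e : x + HahnSeries.C a⁻¹ * (T K s * (ψ - S x)) -
          (y + HahnSeries.C a⁻¹ * (T K s * (ψ - S y))) = -(HahnSeries.C a⁻¹ * (T K s *
            (S (x - y) - HahnSeries.C a * (T K (-s) * (x - y))))) := by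
        have e1 : T K s * T K (-s) = 1 := by rw [T_mul_T, add_neg_cancel, T_zero]
        have e2 := C_mul_C_inv ha0
        rw [map_sub]
        linear_combination (-(x - y) * HahnSeries.C a * HahnSeries.C a⁻¹) * e1 - (x - y) * e2
      rw [e]
      exact h1.neg)
  refine ⟨φ, ?_⟩
  have hφ' : HahnSeries.C a⁻¹ * (T K s * (ψ - S φ)) = 0 := by simpa using hφ
  rcases mul_eq_zero.mp hφ' with h0 | h0
  · exact absurd h0 (HahnSeries.C_ne_zero (inv_ne_zero ha0))
  · rcases mul_eq_zero.mp h0 with h0 | h0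
    · exact absurd h0 (T_ne_zero _)
    · exact (sub_eq_zero.mp h0).symm

/-- To lowest order `(∂ + t⁻¹ + h)ⁱ·1` varies with `h` like `(t⁻¹ + h)ⁱ`, whose derivative is `i
t^(1-i)`. This linearises the Riccati equation. -/
theorem Van.conn_pow_sub {h h' : LaurentSeries K} {m : ℤ} (hh : Van 0 h) (hh' : Van 0 h')
    (hs : Van m (h - h')) (i : ℕ) :
    Van (m + 1 - i) ((conn D h ^ i) 1 - (conn D h' ^ i) 1) ∧
    Van (m + 2 - i) ((conn D h ^ i) 1 - (conn D h' ^ i) 1 - (i : LaurentSeries K) *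
      (T K (1 - i) * (h - h'))) := by
  have hone : Van 0 (1 : LaurentSeries K) := van_T 0
  have hN : ∀ n : ℕ, Van 0 (n : LaurentSeries K) := fun n => by
    have := van_C (n : K)
    rwa [map_natCast] at this
  have hlead : ∀ i : ℕ, Van (m + 1 - i) ((i : LaurentSeries K) * (T K (1 - i) * (h - h'))) :=
    fun i => ((hN i).mul (hs.T_mul rfl)).mono (by omega)
  have key : ∀ i : ℕ, Van (m + 2 - i) ((conn D h ^ i) 1 - (conn D h' ^ i) 1 -
      (i : LaurentSeries K) * (T K (1 - i) * (h - h'))) := by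
    intro i
    induction i with
    | zero => simpa using van_zero _
    | succ i ih =>
      have h1 : Van (m + 1 - i) ((conn D h ^ i) 1 - (conn D h' ^ i) 1) := by
        have := (ih.mono (show m + 1 - i ≤ m + 2 - i by omega)).add (hlead i)
        simpa using this
      have h2 := (hone.conn_pow (D := D) hh' i).2
      rw [mul_one] at h2
      rw [conn_pow_succ, conn_pow_succ]
      set x := (conn D h ^ i) 1
      set y := (conn D h' ^ i) 1
      have e : OreSymbol.serDer D x + (T K (-1) + h) * x - (OreSymbol.serDer D y + (T K (-1) + h') * y) -
          ((i + 1 : ℕ) : LaurentSeries K) * (T K (1 - (i + 1 : ℕ)) * (h - h')) =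
          OreSymbol.serDer D (x - y) + h * (x - y) + T K (-1) * (x - y - (i : LaurentSeries K) *
            (T K (1 - i) * (h - h'))) + (h - h') * (y - T K (-i)) := by
        rw [map_sub, show (1 - (i + 1 : ℕ) : ℤ) = -i by push_cast; ring]
        have : T K (-1) * T K (1 - i) = T K (-i) := by rw [T_mul_T]; congr 1; ring
        push_cast
        linear_combination (i : LaurentSeries K) * (h - h') * this
      rw [e]
      refine (((h1.serDer.mono ?_).add ((hh.mul h1).mono ?_)).add ((ih.T_mul rfl).mono ?_)).add
        ((hs.mul h2).mono ?_)
      all_goals push_cast; omega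
  refine ⟨?_, key i⟩
  have := ((key i).mono (show m + 1 - i ≤ m + 2 - i by omega)).add (hlead i)
  simpa using this

/-- The Riccati equation of `S⁻¹R` has a formal solution of order one. -/
theorem exists_riccati [CharZero K] (R S : K[X]) (hR : R ≠ 0)
    (hlc : R.leadingCoeff = S.leadingCoeff) (hdeg : R.natDegree ≠ S.natDegree) :
    ∃ h : LaurentSeries K, Van 0 h ∧ op (conn D h) (mapC R) 1 =
      T K (S.natDegree - R.natDegree) * op (conn D h) (mapC S) 1 := by
  set r := R.natDegree with hr
  set s := S.natDegree with hs
  set a := R.leadingCoeff with ha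
  have ha0 : a ≠ 0 := leadingCoeff_ne_zero.mpr hR
  let n : K := r - s
  have hn0 : n ≠ 0 := sub_ne_zero.mpr (by exact_mod_cast hdeg)
  have han : a * n ≠ 0 := mul_ne_zero ha0 hn0
  let F : LaurentSeries K → LaurentSeries K := fun h =>
    op (conn D h) (mapC R) 1 - T K (s - r) * op (conn D h) (mapC S) 1
  have hF : ∀ h, F h = op (conn D h) (mapC R) 1 -
    T K (s - r) * op (conn D h) (mapC S) 1 := fun _ => rfl
  have hsingle : ∀ (p : K[X]) (m : ℤ) (h h' : LaurentSeries K), Van 0 h → Van 0 h' → Van m (h - h') →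
      Van (m + 2 - p.natDegree) (op (conn D h) (mapC p) 1 -
        op (conn D h') (mapC p) 1 - HahnSeries.C p.leadingCoeff *
          ((p.natDegree : LaurentSeries K) * (T K (1 - p.natDegree) * (h - h')))) := by
    intro p m h h' hh hh' hs
    have h1 := van_sum_sub p.coeff (fun i => (conn D h ^ i) 1 - (conn D h' ^ i) 1) (m + 1)
      (fun i => (Van.conn_pow_sub (D := D) hh hh' hs i).1) p.natDegree
    have h2 := (Van.conn_pow_sub (D := D) hh hh' hs p.natDegree).2.C_mul p.leadingCoeff
    have h3 := (h1.mono (show m + 2 - p.natDegree ≤ m + 1 + 1 - p.natDegree by omega)).add h2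
    rw [op_map_C_apply, op_map_C_apply, ← Finset.sum_sub_distrib]
    convert h3 using 1
    simp only [coeff_natDegree, mul_sub]
    ring
  -- A Newton iteration for `F h = 0` with a fixed slope: `F` has linear part `a(r - s) t^(1-r)`,
  -- and the step divides by it. This needs `r ≠ s` and characteristic zero.
  obtain ⟨h, hh, hfix⟩ := exists_fixed_point
    (fun h => h - HahnSeries.C (a * n)⁻¹ * (T K (r - 1) * F h)) 0 (by
      have hv : ∀ p : K[X], Van (1 - p.natDegree) (op (conn D 0) (mapC p) 1 -
          HahnSeries.C p.leadingCoeff * T K (-p.natDegree)) := by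
        intro p
        have := (van_T (K := K) 0).op_map_C (D := D) (van_zero 0) p
        rwa [zero_add, T_zero, mul_one] at this
      -- Equality of the leading coefficients cancels the terms of degree `-r`, so the correction
      -- has no negative powers of `t`.
      have h1 : Van (1 - r) (F 0) := by
        have e : F 0 = (op (conn D 0) (mapC R) 1 -
            HahnSeries.C a * T K (-r)) - T K (s - r) * (op (conn D 0) (mapC S) 1 -
            HahnSeries.C S.leadingCoeff * T K (-s)) := by
          have : T K (s - r) * T K (-s) = T K (-r) := by rw [T_mul_T]; congr 1; ring
          rw [hF, ← hlc]
          linear_combination -HahnSeries.C a * this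
        rw [e]
        exact (hv R).sub ((hv S).T_mul (by omega))
      simp only [zero_sub]
      exact ((h1.T_mul (by omega)).C_mul _).neg) (by
      intro m _ x y hx hy hxy
      have h1 : Van (m + 2 - r) (F x - F y - HahnSeries.C (a * n) * (T K (1 - r) * (x - y))) := by
        have e : F x - F y - HahnSeries.C (a * n) * (T K (1 - r) * (x - y)) =
            (op (conn D x) (mapC R) 1 - op (conn D y) (mapC R) 1 -
              HahnSeries.C a * ((r : LaurentSeries K) * (T K (1 - r) * (x - y)))) - T K (s - r) *
            (op (conn D x) (mapC S) 1 - op (conn D y) (mapC S) 1 -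
              HahnSeries.C S.leadingCoeff *
                ((s : LaurentSeries K) * (T K (1 - s) * (x - y)))) := by
          have : T K (s - r) * T K (1 - s) = T K (1 - r) := by rw [T_mul_T]; congr 1; ring
          rw [hF, hF, ← hlc, map_mul, map_sub, map_natCast, map_natCast]
          linear_combination (-HahnSeries.C a * s * (x - y)) * this
        rw [e]
        exact (hsingle R m x y hx hy hxy).sub
          ((hsingle S m x y hx hy hxy).T_mul (by omega))
      have e : x - HahnSeries.C (a * n)⁻¹ * (T K (r - 1) * F x) -
          (y - HahnSeries.C (a * n)⁻¹ * (T K (r - 1) * F y)) =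
          -(HahnSeries.C (a * n)⁻¹ * (T K (r - 1) *
            (F x - F y - HahnSeries.C (a * n) * (T K (1 - r) * (x - y))))) := by
        have e1 : T K (r - 1) * T K (1 - r) = 1 := by
          rw [T_mul_T, ← T_zero]; congr 1; ring
        have e2 := C_mul_C_inv han
        linear_combination
          (-(x - y) * HahnSeries.C (a * n) * HahnSeries.C (a * n)⁻¹) * e1 - (x - y) * e2
      rw [e]
      exact ((h1.T_mul (by omega)).C_mul _).neg)
  refine ⟨h, hh, ?_⟩
  have h0 : HahnSeries.C (a * n)⁻¹ * (T K (r - 1) * F h) = 0 := by simpa using hfix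
  rcases mul_eq_zero.mp h0 with h0 | h0
  · exact absurd h0 (HahnSeries.C_ne_zero (inv_ne_zero han))
  · rcases mul_eq_zero.mp h0 with h0 | h0
    · exact absurd h0 (T_ne_zero _)
    · exact sub_eq_zero.mp h0

end Riccati

/-! ### Left ideals of operators, and derivations of their coefficients -/

section Elimination

variable {k B : Type*} [CommRing k] [CommRing B] [Algebra k B]

/-- One step of pseudo-division: cross-multiplying by leading coefficients avoids dividing in `B`.
-/
theorem coeff_smul_nab_pow_sub {d : Derivation k B B} {ρ G : B[X]} {N i : ℕ}
    (hρ : ∀ j, N < j → ρ.coeff j = 0) (hGN : G.natDegree ≤ N) (hi : N ≤ i) :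
    (G.leadingCoeff • ρ - ρ.coeff N • (nab d ^ (N - G.natDegree)) G).coeff i = 0 := by
  rw [coeff_sub, coeff_smul, coeff_smul, smul_eq_mul, smul_eq_mul]
  rcases hi.eq_or_lt with rfl | hlt
  · have := coeff_nab_pow_top (d := d) (N - G.natDegree) G _ le_rfl
    rw [Nat.sub_add_cancel hGN] at this
    rw [this, coeff_natDegree, mul_comm, sub_self]
  · rw [hρ i hlt, coeff_nab_pow_of_lt _ G _ _ le_rfl (by omega), mul_zero, mul_zero, sub_zero]

/-- Division with remainder `0` by an element of minimal order of a left ideal. -/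
theorem exists_smul_eq_star [IsDomain B] {d : Derivation k B B} {J : Submodule B B[X]}
    (hJ : ∀ q ∈ J, nab d q ∈ J) {G : B[X]} (hG : G ∈ J) (hG0 : G ≠ 0)
    (hmin : ∀ q ∈ J, q ≠ 0 → G.natDegree ≤ q.natDegree) {ρ : B[X]} (hρ : ρ ∈ J) :
    ∃ a : B, a ≠ 0 ∧ ∃ A : B[X], a • ρ = star d A G := by
  have hpow : ∀ i, (nab d ^ i) G ∈ J := by
    intro i
    induction i with
    | zero => exact hG
    | succ i ih =>
      rw [pow_succ', Module.End.mul_apply]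
      exact hJ _ ih
  obtain ⟨N, hN⟩ : ∃ N, ∀ i, N ≤ i → ρ.coeff i = 0 :=
    ⟨ρ.natDegree + 1, fun i hi => coeff_eq_zero_of_natDegree_lt hi⟩
  induction N generalizing ρ with
  | zero =>
    have : ρ = 0 := by
      ext i
      exact hN i (Nat.zero_le i)
    exact ⟨1, one_ne_zero, 0, by simp [this, star]⟩
  | succ N ih =>
    by_cases h0 : ρ.coeff N = 0
    · refine ih hρ fun i hi => ?_
      rcases hi.eq_or_lt with rfl | hlt
      · exact h0
      · exact hN i hlt
    have hdeg : ρ.natDegree ≤ N := by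
      rw [natDegree_le_iff_coeff_eq_zero]
      exact fun i hi => hN i hi
    have hρ0 : ρ ≠ 0 := by
      rintro rfl
      exact h0 (coeff_zero _)
    -- Remainders stay in `J`, so by minimality of `G` the division can go on until the remainder is
    -- zero.
    have hle := (hmin ρ hρ hρ0).trans hdeg
    obtain ⟨a, ha, A, hA⟩ := ih
      (J.sub_mem (J.smul_mem G.leadingCoeff hρ) (J.smul_mem (ρ.coeff N) (hpow (N - G.natDegree))))
      (fun i hi => coeff_smul_nab_pow_sub (d := d) (fun j hj => hN j hj) hle hi)
    refine ⟨a * G.leadingCoeff, mul_ne_zero ha (leadingCoeff_ne_zero.mpr hG0),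
      A + monomial (N - G.natDegree) (a * ρ.coeff N), ?_⟩
    rw [star, map_add, LinearMap.add_apply, op_monomial, LinearMap.smul_apply, ← star, ← hA,
      smul_sub, smul_smul, smul_smul, sub_add_cancel]

variable {d δ : Derivation k B B}

theorem mapDer_nab (hcomm : ∀ a, δ (d a) = d (δ a)) (q : B[X]) :
    mapDer δ (nab d q) = nab d (mapDer δ q) := by
  rw [nab_apply, nab_apply, map_add, Derivation.leibniz, mapDer_X, smul_zero, add_zero, smul_eq_mul]
  congr 1
  ext n
  simp [hcomm]

theorem mapDer_smul (a : B) (q : B[X]) :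
    mapDer δ (a • q) = a • mapDer δ q + δ a • q := by
  ext n
  simp only [coeff_mapDer, coeff_smul, coeff_add, smul_eq_mul, Derivation.leibniz]
  ring

/-- Because `δ` commutes with `d`, it extends to a derivation of the ring of operators that kills
`∂`. -/
theorem mapDer_star (hcomm : ∀ a, δ (d a) = d (δ a)) (p q : B[X]) :
    mapDer δ (star d p q) = star d (mapDer δ p) q + star d p (mapDer δ q) := by
  have hpow : ∀ i, mapDer δ ((nab d ^ i) q) = (nab d ^ i) (mapDer δ q) := by
    intro i
    induction i with
    | zero => rfl
    | succ i ih =>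
      rw [pow_succ', Module.End.mul_apply, mapDer_nab hcomm, ih, Module.End.mul_apply]
  unfold star
  induction p using Polynomial.induction_on' with
  | add p p' hp hp' => simp only [map_add, LinearMap.add_apply, hp, hp']; abel
  | monomial i a =>
    rw [mapDer_monomial, op_monomial, op_monomial, LinearMap.smul_apply, LinearMap.smul_apply,
      LinearMap.smul_apply, mapDer_smul, hpow, add_comm]

variable {L : Type*} [CommRing L] [IsDomain L] [Algebra k L] {dL : Derivation k L L}
  {E : Module.End k L}

/-- If a derivation `δ` of the coefficients annihilates an element `ρ₀` of the left annihilator of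
`1`, all of whose left factors are injective, then `δ` preserves the left annihilator of `1`. -/
theorem op_mapDer_eq_zero [IsDomain B] (hE : IsConn dL E) {e : B →+* L} (he : Function.Injective e)
    (hed : ∀ a, e (d a) = dL (e a)) (hcomm : ∀ a, δ (d a) = d (δ a)) {ρ₀ : B[X]} (hρ₀ : ρ₀ ≠ 0)
    (hev : op E (ρ₀.map e) 1 = 0) (hδ : mapDer δ ρ₀ = 0)
    (hinj : ∀ (a : B) (A G : B[X]), a ≠ 0 → a • ρ₀ = star d A G → op E (G.map e) 1 = 0 →
      ∀ φ, op E (A.map e) φ = 0 → φ = 0)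
    {ρ : B[X]} (hρ : op E (ρ.map e) 1 = 0) : op E ((mapDer δ ρ).map e) 1 = 0 := by
  have hstar : ∀ A G : B[X], op E ((star d A G).map e) 1 = op E (A.map e) (op E (G.map e) 1) := by
    intro A G
    rw [map_star e hed, op_star hE, Module.End.mul_apply]
  have hsmul : ∀ (a : B) (p : B[X]), op E ((a • p).map e) 1 = e a * op E (p.map e) 1 := by
    intro a p
    rw [Polynomial.map_smul, map_smul]
    rfl
  let J : Submodule B B[X] :=
    { carrier := {p | op E (p.map e) 1 = 0}
      zero_mem' := by simp
      add_mem' := fun {p q} hp hq => by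
        simp only [Set.mem_ofPred_eq] at hp hq ⊢
        rw [Polynomial.map_add, map_add, LinearMap.add_apply, hp, hq, add_zero]
      smul_mem' := fun a p hp => by
        simp only [Set.mem_ofPred_eq] at hp ⊢
        rw [hsmul, hp, mul_zero] }
  have hJ : ∀ q ∈ J, nab d q ∈ J := by
    intro q hq
    have : nab d q = star d X q := by
      rw [star, ← monomial_one_one_eq_X, op_monomial, one_smul, pow_one]
    change op E ((nab d q).map e) 1 = 0
    rw [this, hstar, show op E (q.map e) 1 = 0 from hq, map_zero]
  obtain ⟨G, ⟨hG, hG0⟩, hmin⟩ := WellFounded.has_min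
    (InvImage.wf (natDegree : B[X] → ℕ) wellFounded_lt) {p | p ∈ J ∧ p ≠ 0} ⟨ρ₀, hev, hρ₀⟩
  have hdiv := fun (ρ : B[X]) (hρ : ρ ∈ J) => exists_smul_eq_star (d := d) hJ hG hG0
    (fun q hq hq0 => not_lt.mp (hmin q ⟨hq, hq0⟩)) hρ
  -- Apply `δ` to `aρ = AG` and evaluate at `1`: the terms containing `ρ·1` or `G·1` vanish.
  have key : ∀ (a : B) (ρ A : B[X]), ρ ∈ J → a • ρ = star d A G →
      e a * op E ((mapDer δ ρ).map e) 1 = op E (A.map e) (op E ((mapDer δ G).map e) 1) := by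
    intro a ρ A hρ h
    have h1 := congrArg (fun p => op E ((mapDer δ p).map e) 1) h
    simp only [mapDer_smul, mapDer_star hcomm, Polynomial.map_add, map_add, LinearMap.add_apply,
      hstar, hsmul] at h1
    rwa [show op E (ρ.map e) 1 = 0 from hρ, show op E (G.map e) 1 = 0 from hG, mul_zero, map_zero,
      add_zero, zero_add] at h1
  -- For `ρ = ρ₀` the left side of `key` is zero, and `A` is injective as a left factor of a
  -- multiple of `ρ₀`. The generator `G` thus passes the property on to all of `J`.
  have hδG : op E ((mapDer δ G).map e) 1 = 0 := by
    obtain ⟨a, ha, A, hA⟩ := hdiv ρ₀ hev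
    refine hinj a A G ha hA hG _ ?_
    rw [← key a ρ₀ A hev hA, hδ, Polynomial.map_zero, map_zero, LinearMap.zero_apply, mul_zero]
  obtain ⟨a, ha, A, hA⟩ := hdiv ρ hρ
  have := key a ρ A hρ hA
  rw [hδG, map_zero] at this
  exact (mul_eq_zero.mp this).resolve_left ((map_ne_zero_iff e he).mpr ha)

end Elimination

/-! ### The lowest part of `R - zS` after the substitution `∂ ↦ ∂ + t⁻¹ + h` -/

section Symbol

variable {k K : Type*} [Field k] [Field K] [Algebra k K] {D : Derivation k K K}

theorem op_serDer_one (p : (LaurentSeries K)[X]) : op (serDer D).toLinearMap p 1 = p.coeff 0 := by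
  rw [op_apply_range _ _ _ (Nat.lt_succ_self _), Finset.sum_eq_single 0]
  · simp
  · intro i _ hi
    obtain ⟨j, rfl⟩ := Nat.exists_eq_succ_of_ne_zero hi
    rw [pow_succ, Module.End.mul_apply, Derivation.coeFn_coe, Derivation.map_one_eq_zero, map_zero,
      smul_zero]
  · intro h
    simp at h

/-- The plain derivation kills `1`, so only the constant term survives there. Killing the
eigenfunction thus means having no constant term after the twist. -/
theorem coeff_zero_twist (h : LaurentSeries K) (p : (LaurentSeries K)[X]) :
    (twist (serDer D) (T K (-1) + h) p).coeff 0 = op (conn D h) p 1 := by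
  rw [← op_serDer_one (D := D), op_twist (isConn_serDer D)]
  rfl

/-- The start of a binomial expansion: `(∂ + t⁻¹ + h)ⁱ` has constant term about `t⁻ⁱ` and
first-order term about `i t^(1-i) ∂`; each further `∂` costs another factor `t`, of which one
suffices here. -/
theorem van_coeff_nab_add_pow {h : LaurentSeries K} (hh : Van 0 h) (i : ℕ) :
    let u := ((nab (serDer D) + (T K (-1) + h) • (1 : Module.End k (LaurentSeries K)[X])) ^ i) 1
    Van (1 - i) (u.coeff 0 - T K (-i)) ∧
      Van (2 - i) (u.coeff 1 - (i : LaurentSeries K) * T K (1 - i)) ∧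
        ∀ n, Van (2 - i) (u.coeff (n + 2)) := by
  have hN : ∀ n : ℕ, Van 0 (n : LaurentSeries K) := fun n => by
    have := van_C (n : K)
    rwa [map_natCast] at this
  induction i with
  | zero =>
    refine ⟨?_, ?_, fun n => ?_⟩
    · simpa [T_zero] using van_zero _
    · simpa [coeff_one] using van_zero _
    · simpa [coeff_one] using van_zero _
  | succ i ih =>
    intro u
    set v := ((nab (serDer D) + (T K (-1) + h) • (1 : Module.End k (LaurentSeries K)[X])) ^ i) 1
      with hv
    obtain ⟨h0, h1, h2⟩ := ih
    have hu : u = X * v + mapDer (serDer D) v + (T K (-1) + h) • v := by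
      simp only [u]
      rw [pow_succ', Module.End.mul_apply]
      rfl
    have hu0 : u.coeff 0 = serDer D (v.coeff 0) + (T K (-1) + h) * v.coeff 0 := by
      rw [hu]; simp
    have hu' : ∀ n, u.coeff (n + 1) =
        v.coeff n + serDer D (v.coeff (n + 1)) + (T K (-1) + h) * v.coeff (n + 1) := by
      intro n
      rw [hu]; simp
    have hv0 : Van (-i) (v.coeff 0) := by
      have := (h0.mono (show -(i : ℤ) ≤ 1 - i by omega)).add (van_T (-i))
      simpa using this
    have hv1 : Van (1 - i) (v.coeff 1) := by
      have := (h1.mono (show (1 - i : ℤ) ≤ 2 - i by omega)).add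
        (((hN i).mul (van_T (K := K) (1 - i))).mono (show (1 - i : ℤ) ≤ 0 + (1 - i) by omega))
      simpa using this
    have hT : T K (-1) * T K (1 - i) = T K (-i) := by rw [T_mul_T]; congr 1; ring
    have hvn : ∀ n, Van (1 - i) (v.coeff (n + 1)) := by
      intro n
      cases n with
      | zero => exact hv1
      | succ n => exact (h2 n).mono (by omega)
    refine ⟨?_, ?_, fun n => ?_⟩
    · have e : u.coeff 0 - T K (-(i + 1 : ℕ)) = serDer D (v.coeff 0) + h * v.coeff 0 +
          T K (-1) * (v.coeff 0 - T K (-i)) := by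
        rw [hu0, show (-(i + 1 : ℕ) : ℤ) = -1 + -i by push_cast; ring, ← T_mul_T]
        ring
      rw [e]
      refine ((hv0.serDer.mono ?_).add ((hh.mul hv0).mono ?_)).add ((h0.T_mul rfl).mono ?_)
      all_goals push_cast; omega
    · have e : u.coeff 1 - ((i + 1 : ℕ) : LaurentSeries K) * T K (1 - (i + 1 : ℕ)) =
          (v.coeff 0 - T K (-i)) + serDer D (v.coeff 1) + h * v.coeff 1 +
          T K (-1) * (v.coeff 1 - (i : LaurentSeries K) * T K (1 - i)) := by
        rw [hu' 0, show (1 - (i + 1 : ℕ) : ℤ) = -i by push_cast; ring]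
        push_cast
        linear_combination (i : LaurentSeries K) * hT
      rw [e]
      refine (((h0.mono ?_).add (hv1.serDer.mono ?_)).add ((hh.mul hv1).mono ?_)).add
        ((h1.T_mul rfl).mono ?_)
      all_goals push_cast; omega
    · rw [hu' (n + 1)]
      refine (((hvn n).mono ?_).add ((h2 n).serDer.mono ?_)).add
        ((((van_T (-1)).add (hh.mono (by omega))).mul (h2 n)).mono ?_)
      all_goals push_cast; omega

theorem van_coeff_twist {h : LaurentSeries K} (hh : Van 0 h) (p : K[X]) (n : ℕ) :
    Van (2 - p.natDegree) ((twist (serDer D) (T K (-1) + h) (mapC p)).coeff (n + 1) -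
      if n = 0 then HahnSeries.C p.leadingCoeff *
        ((p.natDegree : LaurentSeries K) * T K (1 - p.natDegree)) else 0) := by
  let u : ℕ → (LaurentSeries K)[X] := fun i =>
    ((nab (serDer D) + (T K (-1) + h) • (1 : Module.End k (LaurentSeries K)[X])) ^ i) 1
  have hN : ∀ n : ℕ, Van 0 (n : LaurentSeries K) := fun n => by
    have := van_C (n : K)
    rwa [map_natCast] at this
  have hu : ∀ i : ℕ, Van (2 - i) ((u i).coeff (n + 1) -
      if n = 0 then (i : LaurentSeries K) * T K (1 - i) else 0) := by
    intro i
    obtain ⟨-, h1, h2⟩ := van_coeff_nab_add_pow (D := D) hh i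
    cases n with
    | zero => simpa using h1
    | succ n => simpa using h2 n
  have hu1 : ∀ i : ℕ, Van (1 - i) ((u i).coeff (n + 1)) := by
    intro i
    have h1 : Van (1 - i) (if n = 0 then (i : LaurentSeries K) * T K (1 - i) else 0) := by
      split_ifs
      · exact ((hN i).mul (van_T _)).mono (by omega)
      · exact van_zero _
    have := ((hu i).mono (show (1 - i : ℤ) ≤ 2 - i by omega)).add h1
    simpa using this
  have hsum : (twist (serDer D) (T K (-1) + h) (mapC p)).coeff (n + 1) =
      ∑ i ∈ Finset.range (p.natDegree + 1), HahnSeries.C (p.coeff i) * (u i).coeff (n + 1) := by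
    rw [twist, op_apply_range _ _ _ (Nat.lt_succ_of_le natDegree_map_le), finsetSum_coeff]
    refine Finset.sum_congr rfl fun i _ => ?_
    rw [coeff_smul, smul_eq_mul, coeff_map]
  have h3 := (van_sum_sub p.coeff (fun i => (u i).coeff (n + 1)) 1 hu1 p.natDegree).add
    ((hu p.natDegree).C_mul p.leadingCoeff)
  rw [hsum]
  convert h3 using 1
  · ring
  · simp only [coeff_natDegree]
    split_ifs <;> ring

/-- The leading symbol of `R - zS` in the coordinate adapted to a solution of the Riccati
equation. -/
theorem lead_twist_sub {h : LaurentSeries K} (hh : Van 0 h) {R S : K[X]}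
    (hlc : R.leadingCoeff = S.leadingCoeff)
    (hric : op (conn D h) (mapC R) 1 =
      T K (S.natDegree - R.natDegree) * op (conn D h) (mapC S) 1) :
    PVan (1 - R.natDegree) (twist (serDer D) (T K (-1) + h)
      (mapC R - T K (S.natDegree - R.natDegree) • mapC S)) ∧
    lead K (1 - R.natDegree) (twist (serDer D) (T K (-1) + h)
      (mapC R - T K (S.natDegree - R.natDegree) • mapC S)) =
      C (R.leadingCoeff * (R.natDegree - S.natDegree)) * X := by
  set r := R.natDegree with hr
  set s := S.natDegree with hs
  set W := twist (serDer D) (T K (-1) + h) (mapC R - T K (s - r) • mapC S) with hW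
  have hWcoeff : ∀ n, W.coeff n = (twist (serDer D) (T K (-1) + h) (mapC R)).coeff n -
      T K (s - r) * (twist (serDer D) (T K (-1) + h) (mapC S)).coeff n := by
    intro n
    rw [hW, twist, map_sub, map_smul, LinearMap.sub_apply, LinearMap.smul_apply, coeff_sub,
      coeff_smul, smul_eq_mul]
    rfl
  -- The Riccati equation removes the constant term exactly; otherwise it could dominate the
  -- `∂`-term.
  have h0 : W.coeff 0 = 0 := by
    rw [hWcoeff, coeff_zero_twist, coeff_zero_twist, hric, sub_self]
  -- The `∂`-terms of `R` and `zS` are `a r t^(1-r)` and `a s t^(1-r)`, whence the factor `r - s`.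
  have hn : ∀ n, Van (2 - r) (W.coeff (n + 1) - if n = 0 then
      HahnSeries.C (R.leadingCoeff * (r - s)) * T K (1 - r) else 0) := by
    intro n
    have := (van_coeff_twist (D := D) hh R n).sub
      ((van_coeff_twist (D := D) hh S n).T_mul (j := s - r) (n := 2 - r) (by omega))
    convert this using 1
    rw [hWcoeff, ← hlc, map_mul, map_sub, map_natCast, map_natCast]
    have hT : T K (s - r) * T K (1 - s) = T K (1 - r) := by rw [T_mul_T]; congr 1; ring
    split_ifs
    · linear_combination (-HahnSeries.C R.leadingCoeff * s) * hT
    · ring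
  have hT1 : Van (1 - r) (HahnSeries.C (R.leadingCoeff * (r - s)) * T K (1 - r)) :=
    (van_T _).C_mul _
  refine ⟨fun n => ?_, ?_⟩
  · cases n with
    | zero => rw [h0]; exact van_zero _
    | succ n =>
      have h1 : Van (1 - r) (if n = 0 then
          HahnSeries.C (R.leadingCoeff * (r - s)) * T K (1 - r) else 0) := by
        split_ifs
        · exact hT1
        · exact van_zero _
      have := ((hn n).mono (show (1 - r : ℤ) ≤ 2 - r by omega)).add h1
      simpa using this
  · ext n
    rw [coeff_lead, coeff_C_mul]
    cases n with
    | zero => rw [h0]; simp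
    | succ n =>
      have := hn n (1 - r) (by omega)
      rw [HahnSeries.coeff_sub, sub_eq_zero] at this
      rw [this, coeff_X]
      by_cases hn0 : n = 0
      · subst hn0
        rw [if_pos rfl, if_pos rfl, mul_one, HahnSeries.C_mul_eq_smul, HahnSeries.coeff_smul,
          coeff_T_self, smul_eq_mul, mul_one]
      · rw [if_neg hn0, if_neg (by omega), mul_zero, HahnSeries.coeff_zero]

end Symbol

theorem star_X {k B : Type*} [CommRing k] [CommRing B] [Algebra k B] (d : Derivation k B B)
    (p : B[X]) : star d p X = p * X := by
  have hX : ∀ i, (nab d ^ i) (X : B[X]) = X ^ (i + 1) := by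
    intro i
    rw [← nab_pow_one (d := d) (i + 1), pow_succ (nab d), Module.End.mul_apply]
    congr 1
    simpa using (nab_pow_one (d := d) 1).symm
  induction p using Polynomial.induction_on' with
  | add p q hp hq => rw [add_mul, ← hp, ← hq, star, map_add]; rfl
  | monomial i a =>
    rw [star, op_monomial, LinearMap.smul_apply, hX, smul_X_eq_monomial, monomial_mul_X]

/-! ### Algebraic dependence of the eigenvalues -/

section Independence

variable {k K : Type*} [Field k] [Field K] [Algebra k K] {D : Derivation k K K}

/-- Without a constant term `W` factors as `W'∂`, and `W'` is injective by `injective_op_of_star`.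
-/
theorem serDer_eq_zero_of_op {W : (LaurentSeries K)[X]} {w : ℤ} {c : K} (hc : c ≠ 0)
    (hW : PVan w W) (hlead : lead K w W = C c * X) (hW0 : W.coeff 0 = 0) {φ : LaurentSeries K}
    (hφ : op (serDer D).toLinearMap W φ = 0) : serDer D φ = 0 := by
  have e : star (serDer D) W.divX X = W := by
    rw [star_X]
    simpa [hW0] using divX_mul_X_add W
  rw [← e] at hW hlead
  refine injective_op_of_star hc hW hlead coeff_X_zero ?_
  have h1 : op (serDer D).toLinearMap (X : (LaurentSeries K)[X]) φ = serDer D φ := by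
    rw [← monomial_one_one_eq_X, op_monomial, one_smul, pow_one]
    rfl
  rw [← h1, ← Module.End.mul_apply, ← op_star (isConn_serDer D), e, hφ]

/-- Constants that are linearly independent over the field of constants `k` are linearly
independent over `K`. -/
theorem eq_zero_of_sum_C_mul_eq_zero (hD : ∀ a, D a = 0 → a ∈ Set.range (algebraMap k K))
    {ι : Type*} {v : ι → LaurentSeries K} (hv : ∀ i, serDer D (v i) = 0)
    (hli : LinearIndependent k v) (s : Finset ι) (c : ι → K)
    (h : ∑ i ∈ s, HahnSeries.C (c i) * v i = 0) : ∀ i ∈ s, c i = 0 := by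
  have hb : ∀ i m, ∃ b : k, algebraMap k K b = (v i).coeff m := by
    intro i m
    apply hD
    rw [← coeff_serDer, hv, HahnSeries.coeff_zero]
  choose b hb using hb
  intro i hi
  -- The `v i` have coefficients in `k`, so any `k`-linear functional on `K` turns the relation into
  -- one over `k`.
  rw [← Module.forall_dual_apply_eq_zero_iff k]
  intro f
  refine linearIndependent_iff'.mp hli s (fun i => f (c i)) ?_ i hi
  ext m
  have h1 := congrArg (fun φ => f (HahnSeries.coeff φ m)) h
  simp only [HahnSeries.coeff_sum, HahnSeries.C_mul_eq_smul, HahnSeries.coeff_smul, smul_eq_mul,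
    HahnSeries.coeff_zero, map_zero, map_sum, ← hb] at h1 ⊢
  have h2 : ∀ j, f (c j * algebraMap k K (b j m)) = b j m * f (c j) := by
    intro j
    rw [mul_comm, ← Algebra.smul_def, map_smul, smul_eq_mul]
  simp only [h2] at h1
  rw [← map_zero (algebraMap k K), ← h1, map_sum]
  refine Finset.sum_congr rfl fun j _ => ?_
  rw [Algebra.smul_def, map_mul, mul_comm]

/-- Evaluation of a polynomial in two variables `z, w` with coefficients in `K`. -/
def evalTwo (z q : LaurentSeries K) : K[X][X] →+* LaurentSeries K :=
  eval₂RingHom (eval₂RingHom HahnSeries.C z) q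

theorem evalTwo_monomial (z q : LaurentSeries K) (i j : ℕ) (c : K) :
    evalTwo z q (monomial j (monomial i c)) = HahnSeries.C c * (z ^ i * q ^ j) := by
  simp [evalTwo, eval₂_monomial]

theorem evalTwo_mapDer {z q : LaurentSeries K} (hz : serDer D z = 0) (hq : serDer D q = 0)
    (a : K[X][X]) : evalTwo z q (mapDer (mapDer D) a) = serDer D (evalTwo z q a) := by
  induction a using Polynomial.induction_on' with
  | add a b ha hb => rw [map_add, map_add, ha, hb, map_add, map_add]
  | monomial j p =>
    induction p using Polynomial.induction_on' with
    | add a b ha hb => simp only [map_add, ha, hb]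
    | monomial i c =>
      rw [mapDer_monomial, mapDer_monomial, evalTwo_monomial, evalTwo_monomial, Derivation.leibniz,
        Derivation.leibniz, Derivation.leibniz_pow, Derivation.leibniz_pow, hz, hq, serDer_C]
      simp [mul_comm]

theorem evalTwo_injective (hD : ∀ a, D a = 0 → a ∈ Set.range (algebraMap k K))
    {z q : LaurentSeries K} (hz : serDer D z = 0) (hq : serDer D q = 0)
    (hli : LinearIndependent k fun m : ℕ × ℕ => z ^ m.1 * q ^ m.2) :
    Function.Injective (evalTwo z q) := by
  rw [injective_iff_map_eq_zero]
  intro a ha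
  have hv : ∀ m : ℕ × ℕ, serDer D (z ^ m.1 * q ^ m.2) = 0 := by
    intro m
    rw [Derivation.leibniz, Derivation.leibniz_pow, Derivation.leibniz_pow, hz, hq]
    simp
  obtain ⟨N, hN⟩ : ∃ N, ∀ j, (a.coeff j).natDegree < N :=
    ⟨(a.support.sup fun j => (a.coeff j).natDegree) + 1, fun j => by
      by_cases hj : j ∈ a.support
      · exact Nat.lt_succ_of_le (Finset.le_sup (f := fun j => (a.coeff j).natDegree) hj)
      · rw [notMem_support_iff.mp hj, natDegree_zero]
        exact Nat.succ_pos _⟩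
  have e : evalTwo z q a = ∑ m ∈ Finset.range N ×ˢ Finset.range (a.natDegree + 1),
      HahnSeries.C ((a.coeff m.2).coeff m.1) * (z ^ m.1 * q ^ m.2) := by
    conv_lhs => rw [a.as_sum_range, map_sum]
    rw [Finset.sum_product_right]
    refine Finset.sum_congr rfl fun j _ => ?_
    conv_lhs => rw [(a.coeff j).as_sum_range' N (hN j), map_sum, map_sum]
    exact Finset.sum_congr rfl fun i _ => evalTwo_monomial z q i j _
  rw [ha] at e
  have hc := eq_zero_of_sum_C_mul_eq_zero hD hv hli _ _ e.symm
  ext j i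
  rw [coeff_zero, coeff_zero]
  by_cases hj : j < a.natDegree + 1
  · by_cases hi : i < N
    · exact hc (i, j) (Finset.mem_product.mpr ⟨Finset.mem_range.mpr hi, Finset.mem_range.mpr hj⟩)
    · exact coeff_eq_zero_of_natDegree_lt ((hN j).trans_le (not_lt.mp hi))
  · rw [coeff_eq_zero_of_natDegree_lt (n := j) (by omega), coeff_zero]

/-- The constant eigenvalues of `S⁻¹R` and `V⁻¹U` on a common formal eigenfunction are algebraically
dependent over `K`. -/
theorem not_injective_evalTwo [CharZero K] {h : LaurentSeries K} (hh : Van 0 h) {R S U V : K[X]}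
    (hR : R ≠ 0) (hlc : R.leadingCoeff = S.leadingCoeff) (hdeg : R.natDegree ≠ S.natDegree)
    (hric : op (conn D h) (mapC R) 1 =
      T K (S.natDegree - R.natDegree) * op (conn D h) (mapC S) 1)
    {q : LaurentSeries K} (hq : serDer D q = 0) (hV : V ≠ 0)
    (hUV : op (conn D h) (mapC U) 1 = q * op (conn D h) (mapC V) 1) :
    ¬ Function.Injective (evalTwo (T K (S.natDegree - R.natDegree)) q) := by
  set z := T K (S.natDegree - R.natDegree) with hz
  intro he
  let ι : K →+* K[X][X] := (C : K[X] →+* K[X][X]).comp C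
  -- In `K[X][X]` the inner variable stands for `z` and the outer one for `q`; `δ` differentiates in
  -- the outer one, so it kills `ρ₀` but not `ρ₁`.
  let δ : Derivation k K[X][X] K[X][X] := (derivative' (R := K[X])).restrictScalars k
  have hδ : ∀ a, δ a = derivative a := fun _ => rfl
  have hι : (evalTwo z q).comp ι = HahnSeries.C := by
    ext1 a
    simp [evalTwo, ι]
  have hδι : ∀ p : K[X], mapDer δ (p.map ι) = 0 := by
    intro p
    ext1 n
    rw [coeff_mapDer, coeff_map, hδ]
    simp [ι]
  have hmapι : ∀ p : K[X], (p.map ι).map (evalTwo z q) = mapC p := by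
    intro p
    rw [Polynomial.map_map, hι]
  let ρ₀ : K[X][X][X] := R.map ι - (C X : K[X][X]) • S.map ι
  let ρ₁ : K[X][X][X] := U.map ι - (X : K[X][X]) • V.map ι
  have hρ₀ : ρ₀.map (evalTwo z q) = mapC R - z • mapC S := by
    have : evalTwo z q (C X) = z := by simp [evalTwo]
    rw [Polynomial.map_sub, Polynomial.map_smul, hmapι, hmapι, this]
  have hρ₁ : ρ₁.map (evalTwo z q) = mapC U - q • mapC V := by
    have : evalTwo z q X = q := by simp [evalTwo]
    rw [Polynomial.map_sub, Polynomial.map_smul, hmapι, hmapι, this]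
  have hc : R.leadingCoeff * (R.natDegree - S.natDegree) ≠ 0 :=
    mul_ne_zero (leadingCoeff_ne_zero.mpr hR) (sub_ne_zero.mpr (by exact_mod_cast hdeg))
  obtain ⟨hW, hlead⟩ := lead_twist_sub hh hlc hric
  rw [← hz, ← hρ₀] at hW hlead
  have hρ₀0 : ρ₀ ≠ 0 := by
    intro h0
    rw [h0, Polynomial.map_zero, twist, map_zero, LinearMap.zero_apply, map_zero] at hlead
    exact mul_ne_zero (C_ne_zero.mpr hc) X_ne_zero hlead.symm
  have hed := evalTwo_mapDer (D := D) (serDer_T D (S.natDegree - R.natDegree)) hq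
  rw [← hz] at hed
  have hρ₁ev : op (conn D h) (ρ₁.map (evalTwo z q)) 1 = 0 := by
    rw [hρ₁, map_sub, map_smul, LinearMap.sub_apply, LinearMap.smul_apply, hUV, smul_eq_mul,
      sub_self]
  have hfinal := op_mapDer_eq_zero (δ := δ) (d := mapDer (mapDer D)) (isConn_conn D h) he hed
    (fun a => by
      ext1 n
      rw [hδ, hδ, coeff_derivative, coeff_mapDer, coeff_mapDer, coeff_derivative,
        Derivation.leibniz]
      have : ((n : K[X]) + 1) = ((n + 1 : ℕ) : K[X]) := by push_cast; rfl
      rw [this, Derivation.map_natCast, smul_zero, zero_add, smul_eq_mul, mul_comm])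
    hρ₀0 (by rw [hρ₀, map_sub, map_smul, LinearMap.sub_apply, LinearMap.smul_apply, hric,
      smul_eq_mul, sub_self])
    (by
      rw [map_sub, hδι, mapDer_smul, hδι, smul_zero, zero_add, hδ, derivative_C, zero_smul,
        sub_zero])
    -- After the twist, `a • ρ₀` still has lowest part a nonzero multiple of `∂`: the lowest
    -- coefficient of `a` only rescales `c`.
    (fun a A G ha hA hG φ hφ => by
      have h1 := congrArg (fun p => twist (serDer D) (T K (-1) + h) (p.map (evalTwo z q))) hA
      simp only [Polynomial.map_smul, twist_smul, map_star _ hed, twist_star] at h1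
      have hea : evalTwo z q a ≠ 0 := (map_ne_zero_iff _ he).mpr ha
      obtain ⟨l, hl, hl0⟩ := exists_van_coeff_ne_zero hea
      refine injective_op_of_star (D := D) (A := twist (serDer D) (T K (-1) + h)
        (A.map (evalTwo z q))) (G := twist (serDer D) (T K (-1) + h) (G.map (evalTwo z q)))
        (w := l + (1 - R.natDegree)) (mul_ne_zero hl0 hc) ?_ ?_ ?_ ?_
      · rw [← h1]
        intro n
        rw [coeff_smul, smul_eq_mul]
        exact hl.mul (hW n)
      · rw [← h1]
        ext n
        have := congrArg (fun p => p.coeff n) hlead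
        simp only [coeff_lead] at this
        rw [coeff_lead, coeff_smul, smul_eq_mul, hl.coeff_mul (hW n), this, coeff_C_mul,
          coeff_C_mul]
        ring
      · rw [coeff_zero_twist, hG]
      · rw [op_twist (isConn_serDer D)]
        exact hφ)
    hρ₁ev
  have hδρ₁ : mapDer δ ρ₁ = -V.map ι := by
    rw [map_sub, hδι, mapDer_smul, hδι, smul_zero, zero_add, hδ, derivative_X, one_smul, zero_sub]
  rw [hδρ₁, Polynomial.map_neg, hmapι, map_neg, LinearMap.neg_apply, neg_eq_zero] at hfinal
  -- Preservation of the annihilator has produced `V·1 = 0`, although `V` acts injectively.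
  have := injective_op_map_C (D := D) hh hV (hfinal.trans (map_zero _).symm)
  exact one_ne_zero this

end Independence

end OreSymbol

/-! ### The field `ℂ((x))`, and the action of differential operators on series over it -/

namespace FracDiff

open Polynomial OreSymbol
open scoped PowerSeries nonZeroDivisors

local instance (priority := 2000) instAlgebraLaurentSeries {k K : Type*} [Field k] [Field K]
    [Algebra k K] : Algebra k (LaurentSeries K) :=
  HahnSeries.instAlgebra

/-- The Euler derivation `x d/dx` of `ℂ((x))`. -/
def euler : Derivation ℂ (LaurentSeries ℂ) (LaurentSeries ℂ) :=
  Derivation.mk'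
    { toFun := fun φ => HahnSeries.ofSuppBddBelow (fun n => (n : ℂ) * φ.coeff n)
        ⟨φ.order, fun n hn => not_lt.mp fun hlt => hn (by
          simp [HahnSeries.coeff_eq_zero_of_lt_order hlt])⟩
      map_add' := fun φ ψ => by ext n; exact mul_add (n : ℂ) (φ.coeff n) (ψ.coeff n)
      map_smul' := fun c φ => by ext n; exact mul_left_comm (n : ℂ) c (φ.coeff n) }
    fun φ ψ => by
      set f : LaurentSeries ℂ → LaurentSeries ℂ := fun φ =>
        HahnSeries.ofSuppBddBelow (fun n => (n : ℂ) * φ.coeff n)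
          ⟨φ.order, fun n hn => not_lt.mp fun hlt => hn (by
            simp [HahnSeries.coeff_eq_zero_of_lt_order hlt])⟩ with hf
      have hfc : ∀ χ n, (f χ).coeff n = (n : ℂ) * χ.coeff n := fun _ _ => rfl
      have hs : ∀ χ, (f χ).support ⊆ χ.support := by
        intro χ i hi h0
        exact hi (by rw [hfc, h0, mul_zero])
      change f (φ * ψ) = φ * f ψ + ψ * f φ
      ext n
      rw [HahnSeries.coeff_add, mul_comm ψ, HahnSeries.coeff_mul_right' (y := f ψ)
        ψ.isPWO_support (hs ψ), HahnSeries.coeff_mul_left' (x := f φ) φ.isPWO_support (hs φ), hfc,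
        HahnSeries.coeff_mul, Finset.mul_sum, ← Finset.sum_add_distrib]
      refine Finset.sum_congr rfl fun p hp => ?_
      rw [Finset.mem_antidiagonal] at hp
      rw [hfc, hfc, ← hp.2.2]
      push_cast
      ring

theorem coeff_euler (φ : LaurentSeries ℂ) (n : ℤ) : (euler φ).coeff n = (n : ℂ) * φ.coeff n := rfl

theorem coeff_smul_euler (φ : LaurentSeries ℂ) (n : ℤ) :
    ((T ℂ (-1) • euler) φ).coeff n = ((n : ℂ) + 1) * φ.coeff (n + 1) := by
  change (T ℂ (-1) * euler φ).coeff n = _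
  rw [T, HahnSeries.coeff_single_mul, coeff_euler]
  simp

/-- The field `ℂ((x))`. -/
def LaurentField : Type := LaurentSeries ℂ

instance instFieldLaurentField : Field LaurentField := inferInstanceAs (Field (LaurentSeries ℂ))

instance instAlgebraLaurentField : Algebra ℂ LaurentField :=
  inferInstanceAs (Algebra ℂ (LaurentSeries ℂ))

instance instCharZeroLaurentField : CharZero LaurentField :=
  charZero_of_injective_algebraMap (algebraMap ℂ LaurentField).injective

/-- The coefficients of a Laurent series. -/
def LaurentField.coeff (φ : LaurentField) (n : ℤ) : ℂ := HahnSeries.coeff (Γ := ℤ) (R := ℂ) φ n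

theorem LaurentField.ext {φ ψ : LaurentField} (h : ∀ n, φ.coeff n = ψ.coeff n) : φ = ψ :=
  HahnSeries.ext (funext h)

/-- The derivation `d/dx` of `ℂ((x))`. -/
def ddx : Derivation ℂ LaurentField LaurentField := (T ℂ (-1) • euler :)

theorem coeff_ddx (φ : LaurentField) (n : ℤ) :
    (ddx φ).coeff n = ((n : ℂ) + 1) * φ.coeff (n + 1) :=
  coeff_smul_euler φ n

theorem mem_range_of_ddx_eq_zero (φ : LaurentField) (h : ddx φ = 0) :
    φ ∈ Set.range (algebraMap ℂ LaurentField) := by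
  refine ⟨φ.coeff 0, LaurentField.ext fun n => ?_⟩
  change (HahnSeries.single 0 (φ.coeff 0)).coeff n = φ.coeff n
  by_cases hn : n = 0
  · rw [hn, HahnSeries.coeff_single_same]
  · rw [HahnSeries.coeff_single_of_ne hn]
    have h1 := coeff_ddx φ (n - 1)
    rw [h, sub_add_cancel, show ((n - 1 : ℤ) : ℂ) + 1 = n by push_cast; ring] at h1
    exact ((mul_eq_zero.mp h1.symm).resolve_left (by exact_mod_cast hn)).symm

/-- The inclusion of `ℂ[[x]]` into `ℂ((x))`. -/
def toLaurent : ℂ⟦X⟧ →+* LaurentField := HahnSeries.ofPowerSeries ℤ ℂ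

theorem toLaurent_C (c : ℂ) : toLaurent (PowerSeries.C c) = algebraMap ℂ LaurentField c :=
  HahnSeries.ofPowerSeries_C c

theorem coeff_toLaurent (a : ℂ⟦X⟧) (n : ℤ) :
    (toLaurent a).coeff n = if n < 0 then 0 else PowerSeries.coeff n.natAbs a :=
  PowerSeries.coeff_coe a n

theorem toLaurent_derivative (a : ℂ⟦X⟧) :
    toLaurent (PowerSeries.derivative ℂ a) = ddx (toLaurent a) := by
  refine LaurentField.ext fun n => ?_
  rw [coeff_ddx, coeff_toLaurent, coeff_toLaurent]
  rcases lt_trichotomy n (-1) with h | h | h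
  · rw [if_pos (by omega), if_pos (by omega), mul_zero]
  · subst h
    simp
  · obtain ⟨m, rfl⟩ := Int.eq_ofNat_of_zero_le (show 0 ≤ n by omega)
    rw [if_neg (by omega), if_neg (by omega), show ((m : ℤ) + 1).natAbs = m + 1 by omega,
      Int.natAbs_natCast, PowerSeries.coeff_derivative]
    push_cast
    ring

theorem dSymb_eq_nab : dSymb = nab (PowerSeries.derivative ℂ) := by
  ext1 q
  ext1 n
  rw [coeff_dSymb, nab_apply, Polynomial.coeff_add, coeff_mapDer]
  rfl

theorem star_eq_star (p q : (ℂ⟦X⟧)[X]) :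
    FracDiff.star p q = OreSymbol.star (PowerSeries.derivative ℂ) p q := by
  rw [FracDiff.star, OreSymbol.star, op_apply, dSymb_eq_nab]

namespace DiffOp

theorem symbol_add (L M : DiffOp) : symbol (L + M) = symbol L + symbol M := by
  apply toEnd_injective
  rw [map_add, toEnd_symbol, toEnd_symbol, toEnd_symbol]
  rfl

theorem symbol_algebraMap (c : ℂ) :
    symbol (algebraMap ℂ DiffOp c) = Polynomial.C (PowerSeries.C c) := by
  apply toEnd_injective
  rw [toEnd_symbol, ← Polynomial.monomial_zero_left, toEnd_monomial, pow_zero]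
  ext1 f
  change (algebraMap ℂ (Module.End ℂ ℂ⟦X⟧) c) f = _
  simp [Module.algebraMap_end_apply, PowerSeries.smul_eq_C_mul]

/-- The full symbol of a differential operator, with coefficients in `ℂ((x))`. -/
def laurentSymbol (L : DiffOp) : LaurentField[X] := (symbol L).map toLaurent

theorem toLaurent_injective : Function.Injective toLaurent :=
  HahnSeries.ofPowerSeries_injective

theorem laurentSymbol_ne_zero {L : DiffOp} (hL : L ≠ 0) : laurentSymbol L ≠ 0 := by
  rw [laurentSymbol, Polynomial.map_ne_zero_iff toLaurent_injective]
  exact symbol_eq_zero.not.mpr hL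

theorem natDegree_laurentSymbol (L : DiffOp) : (laurentSymbol L).natDegree = order L :=
  natDegree_map_eq_of_injective toLaurent_injective _

theorem leadingCoeff_laurentSymbol (L : DiffOp) :
    (laurentSymbol L).leadingCoeff = toLaurent (leadingCoeff L) :=
  leadingCoeff_map_of_injective toLaurent_injective _

/-- The action of differential operators on Laurent series over `ℂ((x))`, with `∂` acting through
the connection `∂ + t⁻¹ + h`. -/
def act (h : LaurentSeries LaurentField) :
    DiffOp →+* Module.End ℂ (LaurentSeries LaurentField) where
  toFun L := op (conn ddx h) (mapC (laurentSymbol L))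
  map_zero' := by
    rw [laurentSymbol, symbol_eq_zero.mpr rfl]
    simp
  map_one' := by
    rw [laurentSymbol, ← map_one (algebraMap ℂ DiffOp), symbol_algebraMap]
    simp [op_one]
  map_add' L M := by
    rw [laurentSymbol, symbol_add, Polynomial.map_add, mapC, Polynomial.map_add, map_add]
    rfl
  map_mul' L M := by
    rw [laurentSymbol, symbol_mul, star_eq_star, OreSymbol.map_star toLaurent toLaurent_derivative, mapC,
      OreSymbol.map_star _ fun a => (serDer_C ddx a).symm, op_star (isConn_conn ddx h)]
    rfl

theorem act_apply (h : LaurentSeries LaurentField) (L : DiffOp) :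
    act h L = op (conn ddx h) (mapC (laurentSymbol L)) := rfl

theorem act_algebraMap (h : LaurentSeries LaurentField) (c : ℂ)
    (φ : LaurentSeries LaurentField) : act h (algebraMap ℂ DiffOp c) φ = c • φ := by
  rw [act_apply, laurentSymbol, symbol_algebraMap, Polynomial.map_C, mapC, Polynomial.map_C,
    ← Polynomial.monomial_zero_left, op_monomial, pow_zero]
  change HahnSeries.C (toLaurent (PowerSeries.C c)) * φ = c • φ
  rw [toLaurent_C, HahnSeries.C_mul_eq_smul, algebraMap_smul]

/-- Invertibility is what the universal property of the Ore localization requires in order to extend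
the action to fractions. -/
theorem isUnit_act {h : LaurentSeries LaurentField} (hh : Van 0 h) {L : DiffOp}
    (hL : L ≠ 0) : IsUnit (act h L) := by
  rw [Module.End.isUnit_iff]
  exact ⟨injective_op_map_C hh (laurentSymbol_ne_zero hL),
    surjective_op_map_C hh (laurentSymbol_ne_zero hL)⟩

end DiffOp

/-! ### The action of fractional operators -/

namespace FracDiffOp

variable {h : LaurentSeries LaurentField} (hh : Van 0 h)

/-- Nonzero differential operators act invertibly on Laurent series over `ℂ((x))`. -/
def actUnits : DiffOp⁰ →* (Module.End ℂ (LaurentSeries LaurentField))ˣ :=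
  IsUnit.liftRight ((DiffOp.act h).toMonoidHom.comp (DiffOp⁰).subtype)
    fun s => DiffOp.isUnit_act hh (nonZeroDivisors.ne_zero s.2)

theorem act_eq_actUnits (s : DiffOp⁰) :
    DiffOp.act h s = (actUnits hh s : Module.End ℂ (LaurentSeries LaurentField)) := rfl

/-- The action of fractional differential operators on Laurent series over `ℂ((x))`. -/
def fracAct : FracDiffOp →+* Module.End ℂ (LaurentSeries LaurentField) :=
  OreLocalization.universalHom (DiffOp.act h) (actUnits hh) (act_eq_actUnits hh)

theorem act_fracAct (r : DiffOp) (s : DiffOp⁰) (φ : LaurentSeries LaurentField) :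
    DiffOp.act h s (fracAct hh (r /ₒ s) φ) = DiffOp.act h r φ := by
  rw [fracAct, OreLocalization.universalHom_apply, ← Module.End.mul_apply, ← mul_assoc,
    act_eq_actUnits hh, Units.mul_inv, one_mul]

theorem injective_act (hh : Van 0 h) (s : DiffOp⁰) : Function.Injective (DiffOp.act h s) :=
  ((Module.End.isUnit_iff _).mp (DiffOp.isUnit_act hh (nonZeroDivisors.ne_zero s.2))).1

theorem fracAct_mul_of_const {c : LaurentSeries LaurentField} (hc : serDer ddx c = 0)
    (A : FracDiffOp) (φ : LaurentSeries LaurentField) :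
    fracAct hh A (c * φ) = c * fracAct hh A φ := by
  induction A using OreLocalization.ind with
  | _ r s =>
    apply injective_act hh s
    rw [act_fracAct, DiffOp.act_apply, op_conn_mul_of_const hc, DiffOp.act_apply,
      op_conn_mul_of_const hc, ← DiffOp.act_apply, ← DiffOp.act_apply, act_fracAct]

theorem fracAct_smul (c : ℂ) (A : FracDiffOp) (φ : LaurentSeries LaurentField) :
    fracAct hh (c • A) φ = c • fracAct hh A φ := by
  have e : algebraMap ℂ FracDiffOp c = (algebraMap ℂ DiffOp c) /ₒ (1 : DiffOp⁰) := by
    rw [Algebra.algebraMap_eq_smul_one, Algebra.algebraMap_eq_smul_one, OreLocalization.one_def,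
      OreLocalization.smul_oreDiv_one]
  rw [Algebra.smul_def, map_mul, Module.End.mul_apply, e, ← DiffOp.act_algebraMap h]
  have := act_fracAct hh (algebraMap ℂ DiffOp c) 1 (fracAct hh A φ)
  simpa using this

/-- A nonzero numerator acts injectively. Polynomial relations between `P` and `Q` can therefore be
tested on the single vector `1`. -/
theorem eq_zero_of_fracAct_one {A : FracDiffOp} (hA : fracAct hh A 1 = 0) : A = 0 := by
  induction A using OreLocalization.ind with
  | _ r s =>
    have h1 := act_fracAct hh r s 1
    rw [hA, map_zero] at h1
    by_cases hr : r = 0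
    · rw [hr, OreLocalization.zero_oreDiv]
    · have := injective_act hh ⟨r, mem_nonZeroDivisors_of_ne_zero hr⟩ (h1.symm.trans
        (map_zero (DiffOp.act h r)).symm)
      exact absurd this one_ne_zero

theorem fracAct_pow_mul_pow {P Q : FracDiffOp} {z q : LaurentSeries LaurentField}
    (hz : serDer ddx z = 0) (hq : serDer ddx q = 0) (hP : fracAct hh P 1 = z)
    (hQ : fracAct hh Q 1 = q) (i j : ℕ) : fracAct hh (P ^ i * Q ^ j) 1 = z ^ i * q ^ j := by
  have hpow : ∀ {A : FracDiffOp} {c : LaurentSeries LaurentField}, serDer ddx c = 0 →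
      fracAct hh A 1 = c → ∀ n, fracAct hh (A ^ n) 1 = c ^ n := by
    intro A c hc hA n
    induction n with
    | zero =>
      rw [pow_zero, pow_zero]
      exact LinearMap.congr_fun (map_one (fracAct hh)) 1
    | succ n ih =>
      have := fracAct_mul_of_const hh hc (A ^ n) 1
      rw [mul_one] at this
      rw [pow_succ, map_mul, Module.End.mul_apply, hA, this, ih, pow_succ, mul_comm]
  have hqj : serDer ddx (q ^ j) = 0 := by
    rw [Derivation.leibniz_pow, hq]
    simp
  have := fracAct_mul_of_const hh hqj (P ^ i) 1
  rw [mul_one] at this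
  rw [map_mul, Module.End.mul_apply, hpow hq hQ, this, hpow hz hP, mul_comm]

theorem algDependent_of_not_linearIndependent {P Q : FracDiffOp}
    {z q : LaurentSeries LaurentField} (hz : serDer ddx z = 0) (hq : serDer ddx q = 0)
    (hP : fracAct hh P 1 = z) (hQ : fracAct hh Q 1 = q)
    (hli : ¬ LinearIndependent ℂ fun m : Fin 2 →₀ ℕ => z ^ m 0 * q ^ m 1) :
    AlgDependent P Q := by
  rw [linearIndependent_iff'] at hli
  push Not at hli
  obtain ⟨s, c, hsum, m, hm, hne⟩ := hli
  classical
  let F : MvPolynomial (Fin 2) ℂ := ∑ m ∈ s, MvPolynomial.monomial m (c m)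
  have hF : ∀ m, F.coeff m = if m ∈ s then c m else 0 := by
    intro m
    rw [MvPolynomial.coeff_sum]
    simp only [MvPolynomial.coeff_monomial]
    exact Finset.sum_ite_eq' s m c
  have hsupp : F.support ⊆ s := by
    intro m hm
    rw [MvPolynomial.mem_support_iff, hF] at hm
    by_contra h
    exact hm (if_neg h)
  refine ⟨F, fun h0 => ?_, eq_zero_of_fracAct_one hh ?_⟩
  · have := hF m
    rw [h0, MvPolynomial.coeff_zero, if_pos hm] at this
    exact hne this.symm
  · rw [evalPair, map_sum, LinearMap.sum_apply, ← hsum]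
    refine (Finset.sum_subset hsupp fun m _ hm => ?_).trans (Finset.sum_congr rfl fun m hm => ?_)
    · rw [fracAct_smul, MvPolynomial.notMem_support_iff.mp hm, zero_smul]
    · rw [fracAct_smul, fracAct_pow_mul_pow hh hz hq hP hQ, hF, if_pos hm]

end FracDiffOp

/-! ### Assembly of the proof -/

open FracDiffOp in
/-- A monic fractional differential operator of nonzero order is algebraically dependent on every
operator commuting with it. -/
theorem algDependent_of_commute (P Q : FracDiffOp) (hcomm : Commute P Q)
    (hmonic : P.IsMonic) (hord : P.order ≠ 0) : AlgDependent P Q := by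
  classical
  induction P using OreLocalization.ind with
  | _ R S =>
  induction Q using OreLocalization.ind with
  | _ U V =>
  have hS : (S : DiffOp) ≠ 0 := nonZeroDivisors.ne_zero S.2
  have hlc : toLaurent R.leadingCoeff / toLaurent (S : DiffOp).leadingCoeff = 1 := hmonic
  -- The zero operator has order `⊥ ≠ 0`, so it is monicity that excludes it.
  have hR : R ≠ 0 := by
    rintro rfl
    rw [DiffOp.leadingCoeff_eq_zero.mpr rfl, map_zero, zero_div] at hlc
    exact zero_ne_one hlc
  replace hlc := eq_of_div_eq_one hlc
  have hdeg : R.order ≠ (S : DiffOp).order := by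
    intro h0
    apply hord
    change (if R = 0 then ⊥ else (((R.order : ℤ) - (S : DiffOp).order : ℤ) : WithBot ℤ)) = 0
    rw [if_neg hR, h0, sub_self]
    rfl
  rw [← DiffOp.leadingCoeff_laurentSymbol, ← DiffOp.leadingCoeff_laurentSymbol] at hlc
  rw [← DiffOp.natDegree_laurentSymbol, ← DiffOp.natDegree_laurentSymbol] at hdeg
  have hR' := DiffOp.laurentSymbol_ne_zero hR
  obtain ⟨h, hh, hric⟩ := exists_riccati (D := ddx) _ _ hR' hlc hdeg
  obtain ⟨hW, hlead⟩ := lead_twist_sub hh hlc hric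
  set z := T LaurentField ((S : DiffOp).laurentSymbol.natDegree - R.laurentSymbol.natDegree)
    with hz
  have hz0 : serDer ddx z = 0 := serDer_T _ _
  have hP1 : fracAct hh (R /ₒ S) 1 = z := by
    apply injective_act hh S
    have := op_conn_mul_of_const (h := h) hz0 (mapC (S : DiffOp).laurentSymbol) 1
    rw [mul_one] at this
    rw [act_fracAct, DiffOp.act_apply, hric, DiffOp.act_apply, this]
  set q := fracAct hh (U /ₒ V) 1 with hq
  -- Commutation: `Q` maps the `z`-eigenvector `1` of `P` to another `z`-eigenvector.
  have hPq : fracAct hh (R /ₒ S) q = z * q := by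
    have := fracAct_mul_of_const hh hz0 (U /ₒ V) 1
    rw [mul_one] at this
    rw [hq, ← Module.End.mul_apply, ← map_mul, hcomm.eq, map_mul, Module.End.mul_apply, hP1, this]
  -- The eigenvalue equation says that `R - zS` kills `q`, and this operator kills only constants of
  -- `d/dx`.
  have hq0 : serDer ddx q = 0 := by
    have hc : R.laurentSymbol.leadingCoeff * (R.laurentSymbol.natDegree -
        (S : DiffOp).laurentSymbol.natDegree) ≠ 0 :=
      mul_ne_zero (leadingCoeff_ne_zero.mpr hR') (sub_ne_zero.mpr (by exact_mod_cast hdeg))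
    refine serDer_eq_zero_of_op hc hW hlead ?_ ?_
    · rw [coeff_zero_twist, map_sub, map_smul, LinearMap.sub_apply, LinearMap.smul_apply, hric,
        smul_eq_mul, sub_self]
    · rw [op_twist (isConn_serDer ddx)]
      change op (conn ddx h) _ q = 0
      have h1 := act_fracAct hh R S q
      rw [hPq, DiffOp.act_apply, op_conn_mul_of_const hz0] at h1
      rw [map_sub, map_smul, LinearMap.sub_apply, LinearMap.smul_apply, smul_eq_mul, h1,
        DiffOp.act_apply, sub_self]
  have hUV : op (conn ddx h) (mapC U.laurentSymbol) 1 =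
      q * op (conn ddx h) (mapC (V : DiffOp).laurentSymbol) 1 := by
    have h1 := act_fracAct hh U V 1
    rw [← op_conn_mul_of_const hq0, mul_one]
    exact h1.symm
  refine algDependent_of_not_linearIndependent hh hz0 hq0 hP1 rfl fun hli => ?_
  refine not_injective_evalTwo hh hR' hlc hdeg hric hq0
    (DiffOp.laurentSymbol_ne_zero (nonZeroDivisors.ne_zero V.2)) hUV
    (evalTwo_injective mem_range_of_ddx_eq_zero hz0 hq0 ?_)
  have hinj : Function.Injective fun m : ℕ × ℕ =>
      (Finsupp.single 0 m.1 + Finsupp.single 1 m.2 : Fin 2 →₀ ℕ) := by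
    intro m m' h
    have h0 := DFunLike.congr_fun h 0
    have h1 := DFunLike.congr_fun h 1
    simp at h0 h1
    exact Prod.ext h0 h1
  have hfun : (fun m : ℕ × ℕ => z ^ m.1 * q ^ m.2) = (fun m : Fin 2 →₀ ℕ => z ^ m 0 * q ^ m 1) ∘
      fun m : ℕ × ℕ => (Finsupp.single 0 m.1 + Finsupp.single 1 m.2 : Fin 2 →₀ ℕ) := by
    funext m
    simp
  change LinearIndependent ℂ fun m : ℕ × ℕ => z ^ m.1 * q ^ m.2
  rw [hfun]
  exact hli.comp _ hinj

end FracDiff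

end

theorem theoremA (P Q : FracDiff.FracDiffOp) (hcomm : Commute P Q)
    (hmonic : P.IsMonic) (hord : P.order ≠ 0)
    (hQ : Q ∉ Set.range (algebraMap ℂ FracDiff.FracDiffOp)) :
    FracDiff.FracDiffOp.AlgDependent P Q :=
  FracDiff.algDependent_of_commute P Q hcomm hmonic hord
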